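/- **Setting.** Let $\mathcal X$ be a finite-dimensional Euclidean space, $F_i=\sum_{a\in\mathcal A}F_i^a$ ($i=1,2$, $\mathcal A$ finite) monotone Lipschitz operators on $\mathcal X$, and $g_1,g_2:\mathcal X\to(-\infty,\infty]$ proper convex lower semicontinuous. Put $$\mathcal S_2=\{x: 0\in F_2(x)+\partial g_2(x)\},\qquad \mathcal S_1=\{x\in\mathcal S_2:\langle F_1(x),u-x\rangle+g_1(u)-g_1(x)\ge0\ \ \forall u\in\mathcal S_2\},$$ $H^{(F,g)}(x,y)=\langle F(y),x-y\rangle+g(x)-g(y)$, and $$\Theta_{\rm Feas}(x|\mathcal C)=\sup_{y\in\mathcal C}H^{(F_2,g_2)}(x,y),\qquad \Theta_{\rm Opt}(x|\mathcal C\cap\mathcal S_2)=\sup_{y\in\mathcal C\cap\mathcal S_2}H^{(F_1,g_1)}(x,y).$$ Assume that $\mathcal S_1\ne\emptyset$; that $\operatorname{dom}g_1\cap\operatorname{dom}g_2$ is closed and $\sup_{x\in\mathcal B,\,y\in\mathcal C}|g_1(x)-g_1(y)|<\infty$ for all compact $\mathcal B,\mathcal C\subseteq\operatorname{dom}g_1\cap\operatorname{dom}g_2$;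 and the constraint qualification $\mathcal S_1=\{x:0\in F_1(x)+\partial g_1(x)+N_{\mathcal S_2}(x)\}$, where $N_{\mathcal S_2}$ is the normal cone ($N_{\mathcal S_2}(x)=\emptyset$ for $x\notin\mathcal S_2$). **Algorithm.** Let $\theta\in(0,1]$, $\alpha=1-\theta$, $\gamma\in(0,1)$, $\tau_k>0$, let $\beta_k>0$ be nonincreasing, and put $V_k=\beta_kF_1+F_2$, $G_k=\beta_kg_1+g_2$. Let $Q$ be a probability distribution, and $V_k^\xi(x)$, jointly measurable in $(\xi,x)$, a stochastic oracle with $$\mathbb E_{\xi\sim Q}[V_k^{\xi}(x)]=V_k(x),\qquad \mathbb E_{\xi\sim Q}\|V_k^\xi(x)-V_k^\xi(y)\|^2\le\mathcal L_k^2\|x-y\|^2\quad\forall x,y\in\mathcal X,$$ where $\mathcal L_k>0$ and $\sup_k\mathcal L_k<\infty$, and suppose $\tau_k\le\frac{\sqrt\theta}{\mathcal L_k}\gamma$ for all $k\ge0$. From a deterministic $x_0=w_0\in\mathcal X$ the iterates are, for $k\ge 0$, with $z_k=\alpha x_k+(1-\alpha)w_k$, $$y_{k+1}=\operatorname{prox}_{\tau_kG_k}(z_k-\tau_kV_k(w_k)),\qquad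 x_{k+1}=\operatorname{prox}_{\tau_kG_k}\bigl(z_k-\tau_k(V_k(w_k)+V_k^{\xi_k}(y_{k+1})-V_k^{\xi_k}(w_k))\bigr),$$ and $w_{k+1}=x_{k+1}$ with probability $\theta$, $w_{k+1}=w_k$ otherwise; the samples $\xi_k\sim Q$ and the coin tosses are all independent. Here $\operatorname{prox}_g(z)=\operatorname{argmin}_u\{g(u)+\frac12\|u-z\|^2\}$. **Attouch-Czarnecki condition.** Let $\varphi(x,u)=\sup_{y\in\operatorname{dom}g_2}\{H^{(F_2,g_2)}(x,y)+\langle y,u\rangle\}$, $\operatorname{supp}(u|\mathcal S_2)=\sup_{z\in\mathcal S_2}\langle u,z\rangle$ and $h_k(p)=\sup_{z\in\mathcal S_2}\varphi(z,\beta_kp)-\operatorname{supp}(\beta_kp|\mathcal S_2)$, which lies in $[0,\infty]$ for $p$ in the range of $N_{\mathcal S_2}$. Assume $\sum_{k\ge1}\tau_kh_k(p)<\infty$ for all $p$ in the range of $N_{\mathcal S_2}$. **Theorem.** Let $x^*\in\mathcal S_1$. There is $p^*\in N_{\mathcal S_2}(x^*)$ with $-F_1(x^*)-p^*\in\partial g_1(x^*)$;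 fix any such $p^*$, write $h_k=h_k(p^*)$, and let $T_K=\sum_{k=0}^{K-1}\tau_k$, $\bar y^K=\frac1{T_K}\sum_{k=0}^{K-1}\tau_ky_{k+1}$. Then to all compact sets $\mathcal U_1\subseteq\operatorname{dom}g_1$ with $\mathcal U_1\cap\mathcal S_1\ne\emptyset$ and $\mathcal U_2\subseteq\operatorname{dom}g_1\cap\operatorname{dom}g_2$ with $\mathcal U_2\cap\mathcal S_2\neq\emptyset$ there correspond constants $C_{\mathcal U_1},B_{\mathcal U_1}>0$ (depending, as far as the two sets are concerned, only on $\mathcal U_1$) and $C_{\mathcal U_2}>0$ (only on $\mathcal U_2$), independent of $K$, such that for all $K\ge1$ both gaps below are finite for every outcome and integrable, $\operatorname{dist}(\bar y^K,\mathcal S_2)$ is integrable, and the following hold, where the right-hand sides are read in $[0,\infty]$ (the term $h_0$ may be infinite). 1. $\displaystyle \mathbb E[\Theta_{\rm Feas}(\bar y^K|\mathcal U_2)]\le W_{\rm Feas}:=\frac{7}{4T_K}\max_{x\in\mathcal U_2}\|x-x_0\|^2+\frac{7}{2T_K(1-\gamma)}\sum_{k=0}^\infty\tau_kh_k+C_{\mathcal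 U_2}\frac{\sum_{k=0}^{K-1}\tau_k\beta_k}{T_K}+\frac{7}{2T_K(1-\gamma)}\|x^*-x_0\|^2.$ 2. $\displaystyle \mathbb E[\Theta_{\rm Opt}(\bar y^K|\mathcal U_1\cap\mathcal S_2)]\le W_{\rm Opt}:=\frac{C_{\mathcal U_1}}{2T_K\beta_K}+\frac{3}{4T_K}\max_{x\in\mathcal U_1\cap\mathcal S_2}\|x-x_0\|^2+\frac{7}{2(1-\gamma)T_K\beta_K^2}\|x^*-x_0\|^2+\frac{7}{2(1-\gamma)T_K\beta_K^2}\sum_{k=0}^\infty\tau_kh_k.$ 3. $-B_{\mathcal U_1}\operatorname{dist}(\bar y^K,\mathcal S_2)\le\Theta_{\rm Opt}(\bar y^K|\mathcal U_1\cap\mathcal S_2)$ for every outcome, and $-B_{\mathcal U_1}\mathbb E[\operatorname{dist}(\bar y^K,\mathcal S_2)]\le\mathbb E[\Theta_{\rm Opt}(\bar y^K|\mathcal U_1\cap\mathcal S_2)]$. 4. If $\mathcal S_2$ is $(\kappa,\rho)$-weakly sharp, that is, $\kappa>0$, $\rho\ge1$ and $H^{(F_2,g_2)}(z,z^*)\ge\frac\kappa\rho\operatorname{dist}(z,\mathcal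 S_2)^\rho$ for all $z^*\in\mathcal S_2$ and $z\in\operatorname{dom}g_2$, then $\displaystyle -B_{\mathcal U_1}\Bigl[\frac\rho\kappa W_{\rm Feas}\Bigr]^{1/\rho}\le\mathbb E[\Theta_{\rm Opt}(\bar y^K|\mathcal U_1\cap\mathcal S_2)].$ -/

import Mathlib

open MeasureTheory ProbabilityTheory
open scoped ENNReal NNReal Pointwise

namespace HierVI

noncomputable section

section Convex

variable {X : Type*} [NormedAddCommGroup X] [InnerProductSpace ℝ X]

/-- Effective domain of an extended-real-valued function. -/
def dom (g : X → EReal) : Set X := {x | g x < ⊤}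

/-- Proper, convex (convex epigraph), lower semicontinuous functions with values in `(-∞, ∞]`. -/
structure ProperConvexLsc (g : X → EReal) : Prop where
  ne_bot : ∀ x, g x ≠ ⊥
  proper : (dom g).Nonempty
  convex : Convex ℝ {p : X × ℝ | g p.1 ≤ (p.2 : EReal)}
  lsc : LowerSemicontinuous g

/-- Convex subdifferential. -/
def subdiff (g : X → EReal) (x : X) : Set X :=
  {v | ∀ u, g x + ((inner ℝ v (u - x) : ℝ) : EReal) ≤ g u}

/-- Normal cone; empty at the points outside `S`. -/
def normalCone (S : Set X) (x : X) : Set X :=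
  {p | x ∈ S ∧ ∀ z ∈ S, inner ℝ p (z - x) ≤ 0}

/-- Support function. -/
def supp (u : X) (S : Set X) : EReal := ⨆ z ∈ S, ((inner ℝ u z : ℝ) : EReal)

/-- Zeros of a set-valued operator. -/
def zer (M : X → Set X) : Set X := {x | 0 ∈ M x}

/-- Monotone single-valued operators. -/
def MonotoneOp (F : X → X) : Prop := ∀ x y, 0 ≤ inner ℝ (F x - F y) (x - y)

/-- The bifunction `H(x, y) = ⟨F y, x - y⟩ + g x - g y`. -/
def bifun (F : X → X) (g : X → EReal) (x y : X) : EReal :=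
  ((inner ℝ (F y) (x - y) : ℝ) : EReal) + g x - g y

/-- The gap function `Θ(x | F, g, C) = sup_{y ∈ C} H(x, y)`. -/
def gap (F : X → X) (g : X → EReal) (C : Set X) (x : X) : EReal :=
  ⨆ y ∈ C, bifun F g x y

/-- The transform `φ(x, u) = sup_{y ∈ dom g} (H(x, y) + ⟨y, u⟩)`. -/
def phi (F : X → X) (g : X → EReal) (x u : X) : EReal :=
  ⨆ y ∈ dom g, (bifun F g x y + ((inner ℝ y u : ℝ) : EReal))

/-- The variation of `g` over `B × C` (used for `B`, `C` inside the domain of `g`). -/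
def variation (g : X → EReal) (B C : Set X) : ℝ≥0∞ :=
  ⨆ x ∈ B, ⨆ y ∈ C, ENNReal.ofReal |(g x).toReal - (g y).toReal|

/-- The proximal point: a (for proper convex lsc `g`: the) minimizer of `u ↦ g u + ‖u - z‖² / 2`. -/
def prox (g : X → EReal) (z : X) : X :=
  Classical.epsilon fun p =>
    ∀ u, g p + ((‖p - z‖ ^ 2 / 2 : ℝ) : EReal) ≤ g u + ((‖u - z‖ ^ 2 / 2 : ℝ) : EReal)

/-- `S` is `(κ, ρ)`-weakly sharp for the variational inequality with data `(F, g)`. -/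
def WeaklySharp (F : X → X) (g : X → EReal) (S : Set X) (κ ρ : ℝ) : Prop :=
  0 < κ ∧ 1 ≤ ρ ∧ ∀ z' ∈ S, ∀ z ∈ dom g,
    ((κ / ρ * Metric.infDist z S ^ ρ : ℝ) : EReal) ≤ bifun F g z z'

end Convex

/-- Data of a hierarchical variational inequality: the components of the two finite-sum
operators, indexed by a common set, and the two nonsmooth functions. -/
structure Problem (X A : Type*) where
  Fc₁ : A → X → X
  Fc₂ : A → X → X
  g₁ : X → EReal
  g₂ : X → EReal

namespace Problem

variable {X A : Type*} [NormedAddCommGroup X] [InnerProductSpace ℝ X] [Fintype A]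

/-- Upper-level operator. -/
def F₁ (P : Problem X A) (x : X) : X := ∑ a, P.Fc₁ a x

/-- Lower-level operator. -/
def F₂ (P : Problem X A) (x : X) : X := ∑ a, P.Fc₂ a x

/-- Lower-level solution set. -/
def S₂ (P : Problem X A) : Set X := zer fun x => {P.F₂ x} + subdiff P.g₂ x

/-- Solution set of the hierarchical problem. A point outside the domain of `g₁` does not
qualify, since `bifun P.F₁ P.g₁ x x = ⊥` there. -/
def S₁ (P : Problem X A) : Set X := {x ∈ P.S₂ | ∀ u ∈ P.S₂, 0 ≤ bifun P.F₁ P.g₁ u x}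

/-- Feasibility gap. -/
def gapFeas (P : Problem X A) (C : Set X) (x : X) : EReal := gap P.F₂ P.g₂ C x

/-- Optimality gap. -/
def gapOpt (P : Problem X A) (C : Set X) (x : X) : EReal := gap P.F₁ P.g₁ (C ∩ P.S₂) x

/-- The regularized operator `V_k`, for the regularization parameter `b = β_k`. -/
def V (P : Problem X A) (b : ℝ) (x : X) : X := b • P.F₁ x + P.F₂ x

/-- The regularized function `G_k`, for the regularization parameter `b = β_k`. -/
def G (P : Problem X A) (b : ℝ) (x : X) : EReal := (b : EReal) * P.g₁ x + P.g₂ x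

/-- Standing assumptions. -/
structure Standing (P : Problem X A) : Prop where
  sol : P.S₁.Nonempty
  g₁_pcl : ProperConvexLsc P.g₁
  g₂_pcl : ProperConvexLsc P.g₂
  F₁_mono : MonotoneOp P.F₁
  F₂_mono : MonotoneOp P.F₂
  F₁_lip : ∃ L : ℝ≥0, LipschitzWith L P.F₁
  F₂_lip : ∃ L : ℝ≥0, LipschitzWith L P.F₂

/-- Closedness of the common domain, and finite variation of `g₁` over its compact subsets. -/
structure FiniteVariation (P : Problem X A) : Prop where
  closed : IsClosed (dom P.g₁ ∩ dom P.g₂)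
  var : ∀ B C : Set X, IsCompact B → IsCompact C → B ⊆ dom P.g₁ ∩ dom P.g₂ →
    C ⊆ dom P.g₁ ∩ dom P.g₂ → variation P.g₁ B C < ⊤

/-- Constraint qualification. -/
def CQ (P : Problem X A) : Prop :=
  P.S₁ = zer fun x => {P.F₁ x} + subdiff P.g₁ x + normalCone P.S₂ x

/-- The vectors `p* ∈ N_{S₂}(x*)` with `-F₁(x*) - p* ∈ ∂g₁(x*)`. -/
def multipliers (P : Problem X A) (xs : X) : Set X :=
  {p ∈ normalCone P.S₂ xs | -P.F₁ xs - p ∈ subdiff P.g₁ xs}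

/-- `sup_{z ∈ S₂} φ(z, β_k p) - supp(β_k p | S₂)`, for `b = β_k`. -/
def h (P : Problem X A) (b : ℝ) (p : X) : EReal :=
  (⨆ z ∈ P.S₂, phi P.F₂ P.g₂ z (b • p)) - supp (b • p) P.S₂

/-- Attouch-Czarnecki condition. For `p` in the range of the normal cone, the numbers
`P.h (β k) p` lie in `[0, ∞]`, so `toENNReal` does not change them. -/
def AttouchCzarnecki (P : Problem X A) (τ β : ℕ → ℝ) : Prop :=
  ∀ p ∈ ⋃ x, normalCone P.S₂ x,
    ∑' k : ℕ, ENNReal.ofReal (τ (k + 1)) * (P.h (β (k + 1)) p).toENNReal < ⊤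

/-- Stochastic oracle `O k s x = V_k^s(x)`, with the random parameter `s` distributed according
to `Q`: unbiased, and Lipschitz in mean square with bounded constants `ℒ k`. -/
structure Oracle [MeasurableSpace X] (P : Problem X A) (β : ℕ → ℝ) {Ξ : Type*}
    [MeasurableSpace Ξ] (Q : Measure Ξ) (O : ℕ → Ξ → X → X) (ℒ : ℕ → ℝ) : Prop where
  meas : ∀ k, Measurable (Function.uncurry (O k))
  integrable : ∀ k x, Integrable (fun s => O k s x) Q
  unbiased : ∀ k x, ∫ s, O k s x ∂Q = P.V (β k) x
  pos : ∀ k, 0 < ℒ k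
  bdd : BddAbove (Set.range ℒ)
  lip : ∀ k x y, ∫⁻ s, ‖O k s x - O k s y‖ₑ ^ 2 ∂Q ≤ ENNReal.ofReal (ℒ k ^ 2 * ‖x - y‖ ^ 2)

section Algorithm

variable {Ξ : Type*} (P : Problem X A) (α : ℝ) (τ β : ℕ → ℝ) (O : ℕ → Ξ → X → X)

/-- The point `y_{k+1}` computed from `x_k = x` and `w_k = w`. -/
def yStep (k : ℕ) (x w : X) : X :=
  prox (fun u => (τ k : EReal) * P.G (β k) u)
    (α • x + (1 - α) • w - τ k • P.V (β k) w)

/-- The point `x_{k+1}` computed from `x_k = x`, `w_k = w` and the sample `ξ_k = s`. -/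
def xStep (k : ℕ) (x w : X) (s : Ξ) : X :=
  prox (fun u => (τ k : EReal) * P.G (β k) u)
    (α • x + (1 - α) • w
      - τ k • (P.V (β k) w + O k s (P.yStep α τ β k x w) - O k s w))

/-- The pair `(x_k, w_k)` for the samples `s` and the coin tosses `c`: the point `w` is updated
at step `k` exactly if `c k = true`. -/
def iterates (x₀ : X) (s : ℕ → Ξ) (c : ℕ → Bool) : ℕ → X × X
  | 0 => (x₀, x₀)
  | k + 1 =>
    let q := iterates x₀ s c k
    let x' := P.xStep α τ β O k q.1 q.2 (s k)
    (x', if c k then x' else q.2)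

/-- The ergodic average `(∑_{k < K} τ_k y_{k+1}) / ∑_{k < K} τ_k`. -/
def average (x₀ : X) (s : ℕ → Ξ) (c : ℕ → Bool) (K : ℕ) : X :=
  (∑ k ∈ Finset.range K, τ k)⁻¹ • ∑ k ∈ Finset.range K,
    τ k • P.yStep α τ β k (P.iterates α τ β O x₀ s c k).1 (P.iterates α τ β O x₀ s c k).2

end Algorithm

/-- The series `∑_{k ≥ 0} τ_k h_k`, with value in `[0, ∞]`. -/
def hSum (P : Problem X A) (τ β : ℕ → ℝ) (p : X) : ℝ≥0∞ :=
  ∑' k : ℕ, ENNReal.ofReal (τ k) * (P.h (β k) p).toENNReal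

end Problem

/-- The randomness of the algorithm: `ξ k` has law `Q`, the coin `b k` shows `true` with
probability `θ`, and all of these random variables are independent. -/
structure Sampling {Ω Ξ : Type*} [MeasurableSpace Ω] [MeasurableSpace Ξ] (μ : Measure Ω)
    (Q : Measure Ξ) (θ : ℝ) (ξ : ℕ → Ω → Ξ) (b : ℕ → Ω → Bool) : Prop where
  meas_ξ : ∀ k, Measurable (ξ k)
  meas_b : ∀ k, Measurable (b k)
  law_ξ : ∀ k, μ.map (ξ k) = Q
  law_b : ∀ k, μ {ω | b k ω = true} = ENNReal.ofReal θ
  indep_pair : ∀ k, IndepFun (ξ k) (b k) μ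
  indep : iIndepFun (fun k ω => (ξ k ω, b k ω)) μ

section Bounds

variable {X : Type*} [NormedAddCommGroup X]

/-- `T_K = ∑_{k < K} τ_k`. -/
def T (τ : ℕ → ℝ) (K : ℕ) : ℝ := ∑ k ∈ Finset.range K, τ k

/-- `max_{x ∈ U} ‖x - x₀‖²`, for nonempty compact `U`. -/
def maxSqDist (U : Set X) (x₀ : X) : ℝ := sSup ((fun x => ‖x - x₀‖ ^ 2) '' U)

/-- Upper bound for the feasibility gap; `H` stands for `∑ τ_k h_k`. -/
def WFeas (τ β : ℕ → ℝ) (γ : ℝ) (x₀ xs : X) (H : ℝ≥0∞) (U₂ : Set X) (C : ℝ) (K : ℕ) : ℝ≥0∞ :=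
  ENNReal.ofReal (7 / (4 * T τ K) * maxSqDist U₂ x₀)
    + ENNReal.ofReal (7 / (2 * T τ K * (1 - γ))) * H
    + ENNReal.ofReal (C * (∑ k ∈ Finset.range K, τ k * β k) / T τ K)
    + ENNReal.ofReal (7 / (2 * T τ K * (1 - γ)) * ‖xs - x₀‖ ^ 2)

/-- Upper bound for the optimality gap; `U` stands for `U₁ ∩ S₂` and `H` for `∑ τ_k h_k`. -/
def WOpt (τ β : ℕ → ℝ) (γ : ℝ) (x₀ xs : X) (H : ℝ≥0∞) (U : Set X) (C : ℝ) (K : ℕ) : ℝ≥0∞ :=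
  ENNReal.ofReal (C / (2 * T τ K * β K))
    + ENNReal.ofReal (3 / (4 * T τ K) * maxSqDist U x₀)
    + ENNReal.ofReal (7 / (2 * (1 - γ) * T τ K * β K ^ 2) * ‖xs - x₀‖ ^ 2)
    + ENNReal.ofReal (7 / (2 * (1 - γ) * T τ K * β K ^ 2)) * H

end Bounds

end

end HierVI

/-! The analysis rests on the Lyapunov function Φ_k(u) = (1-θ)‖x_k - u‖² + ‖w_k - u‖². For every u
in the common domain, the variational inequalities of the two proximal steps give a pathwise
estimate (`Run.step`): 2τ_k Γ_k(y_{k+1}, u) + Φ_{k+1}(u) is at most Φ_k(u) - (1-γ)a_k + q_k + n_k +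
⟨r_k, u - x₀⟩. The step-size bound gives E q_k ≤ 0. The scalar noise n_k and the vectorial noise r_k
are centered, because the sample ξ_k is independent of the past and the coin is independent of the
past together with the sample.

At u = x* the tilt by the multiplier p* cancels between the two levels and leaves Γ_k ≥ -h_k
(`Run.neg_hk_le`). Taking expectations and summing gives `Run.energy`: E Φ_K(x*) and (1-γ)Σ E a_k
are at most 2‖x*-x₀‖² + 2Σ τ_k h_k.

The gaps are suprema over u inside the expectation, so centering at each fixed u is not enough. The
u-dependent noise is linear in u, however: with weights v_k it sums to ⟨N, u - x₀⟩ ≤ (3/2)‖u-x₀‖² +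
‖N‖²/6, where N = Σ v_k r_k does not depend on u. Orthogonality of martingale differences gives
E‖N‖² ≤ 12 Σ v_k² E a_k, which the energy estimate controls.

For feasibility v_k = 1, and the upper-level part is bounded below uniformly over the compact set,
at a cost proportional to Σ τ_k β_k. For optimality v_k = 1/β_k; the lower-level part is nonnegative
for u in S₂ and can be dropped, while the increasing weights are handled by summation by parts.
Jensen's inequality passes to the ergodic average in both cases. The lower bounds use a multiplier
at a point of U₁ ∩ S₁, and Jensen for the power ρ under weak sharpness. If Σ τ_k h_k = ∞ the upper
bounds are trivial; finiteness and integrability of the gaps come from pathwise bounds that do not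
involve h_k. -/

namespace HierVI

/-! ### Extended-real convex functions and proximal points -/

section Convex

variable {X : Type*} [NormedAddCommGroup X] [InnerProductSpace ℝ X]

namespace ProperConvexLsc

variable {g : X → EReal}

theorem coe_toReal (hg : ProperConvexLsc g) {x : X} (hx : x ∈ dom g) :
    ((g x).toReal : EReal) = g x :=
  EReal.coe_toReal (ne_of_lt hx) (hg.ne_bot x)

theorem eq_top (_hg : ProperConvexLsc g) {x : X} (hx : x ∉ dom g) : g x = ⊤ :=
  not_lt_top_iff.1 hx

theorem convexOn (hg : ProperConvexLsc g) : ConvexOn ℝ (dom g) fun x => (g x).toReal := by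
  have key : ∀ ⦃x⦄, x ∈ dom g → ∀ ⦃y⦄, y ∈ dom g → ∀ ⦃a b : ℝ⦄, 0 ≤ a → 0 ≤ b → a + b = 1 →
      g (a • x + b • y) ≤ ((a * (g x).toReal + b * (g y).toReal : ℝ) : EReal) := by
    intro x hx y hy a b ha hb hab
    have h := hg.convex (x := (x, (g x).toReal)) (y := (y, (g y).toReal))
      (by simp [hg.coe_toReal hx]) (by simp [hg.coe_toReal hy]) ha hb hab
    simpa using h
  have hmem : ∀ ⦃x⦄, x ∈ dom g → ∀ ⦃y⦄, y ∈ dom g → ∀ ⦃a b : ℝ⦄, 0 ≤ a → 0 ≤ b → a + b = 1 →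
      a • x + b • y ∈ dom g := fun x hx y hy a b ha hb hab =>
    (key hx hy ha hb hab).trans_lt (EReal.coe_lt_top _)
  refine ⟨fun x hx y hy a b ha hb hab => hmem hx hy ha hb hab, fun x hx y hy a b ha hb hab => ?_⟩
  have h := key hx hy ha hb hab
  rw [← hg.coe_toReal (hmem hx hy ha hb hab)] at h
  simpa using EReal.coe_le_coe_iff.1 h

theorem lowerSemicontinuousOn (hg : ProperConvexLsc g) :
    LowerSemicontinuousOn (fun x => (g x).toReal) (dom g) := by
  intro x hx r hr
  have h1 : ((r : ℝ) : EReal) < g x := by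
    rw [← hg.coe_toReal hx]; exact_mod_cast hr
  have h2 := (hg.lsc x) _ h1
  filter_upwards [mem_nhdsWithin_of_mem_nhds h2, self_mem_nhdsWithin] with y hy hyd
  rw [← hg.coe_toReal hyd] at hy
  exact_mod_cast hy

theorem bifun_eq (hg : ProperConvexLsc g) (F : X → X) {x y : X} (hx : x ∈ dom g)
    (hy : y ∈ dom g) :
    bifun F g x y = ((inner ℝ (F y) (x - y) + (g x).toReal - (g y).toReal : ℝ) : EReal) := by
  rw [bifun, ← hg.coe_toReal hx, ← hg.coe_toReal hy]
  push_cast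
  simp

theorem subdiff_ineq (hg : ProperConvexLsc g) {x v : X} (hv : v ∈ subdiff g x) :
    x ∈ dom g ∧ ∀ u ∈ dom g, (g x).toReal + inner ℝ v (u - x) ≤ (g u).toReal := by
  have hx : x ∈ dom g := by
    obtain ⟨u, hu⟩ := hg.proper
    by_contra hx
    have h := hv u
    rw [hg.eq_top hx, EReal.top_add_coe] at h
    exact absurd (lt_of_le_of_lt h hu) (lt_irrefl _)
  refine ⟨hx, fun u hu => ?_⟩
  have h := hv u
  rw [← hg.coe_toReal hx, ← hg.coe_toReal hu] at h
  exact_mod_cast h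

end ProperConvexLsc

/-- The affine minorant makes the quadratically perturbed function coercive, so minimization reduces
to a compact piece of `D`, where lower semicontinuity yields a minimizer. -/
theorem exists_prox_real [FiniteDimensional ℝ X] {D : Set X} (hD : IsClosed D) (hne : D.Nonempty)
    {f : X → ℝ} (hf : LowerSemicontinuousOn f D) {v : X} {c : ℝ}
    (hmin : ∀ u ∈ D, c + inner ℝ v u ≤ f u) (z : X) :
    ∃ p ∈ D, ∀ u ∈ D, f p + ‖p - z‖ ^ 2 / 2 ≤ f u + ‖u - z‖ ^ 2 / 2 := by
  obtain ⟨u₀, hu₀⟩ := hne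
  set M := f u₀ + ‖u₀ - z‖ ^ 2 / 2
  set N := M - c - inner ℝ v z
  -- On the sublevel set, s = ‖u - z‖ satisfies s²/2 - ‖v‖s ≤ N; if s > R, the left side exceeds
  -- s(1/2 + |N|) > |N|.
  set R := 2 * ‖v‖ + 1 + 2 * |N|
  have hbound : ∀ u ∈ D, f u + ‖u - z‖ ^ 2 / 2 ≤ M → u ∈ Metric.closedBall z R := by
    intro u hu huM
    rw [mem_closedBall_iff_norm]
    by_contra hlt
    push Not at hlt
    have h1 := hmin u hu
    have h2 : inner ℝ v u = inner ℝ v z + inner ℝ v (u - z) := by rw [← inner_add_right]; simp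
    have h3 : -(‖v‖ * ‖u - z‖) ≤ inner ℝ v (u - z) :=
      (abs_le.1 (abs_real_inner_le_norm v (u - z))).1
    have h4 : ‖u - z‖ ^ 2 / 2 - ‖v‖ * ‖u - z‖ ≤ N := by simp only [N]; linarith
    have h5 : N ≤ |N| := le_abs_self N
    have h6 : 0 ≤ |N| := abs_nonneg N
    have h7 : 0 ≤ ‖v‖ := norm_nonneg v
    simp only [R] at hlt
    nlinarith [mul_nonneg (sub_nonneg.2 hlt.le) (by linarith : 0 ≤ ‖u - z‖)]
  have hlsc : LowerSemicontinuousOn (fun u => f u + ‖u - z‖ ^ 2 / 2) (D ∩ Metric.closedBall z R) :=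
    (hf.mono Set.inter_subset_left).add
      ((by fun_prop : Continuous fun u : X => ‖u - z‖ ^ 2 / 2).lowerSemicontinuous.lowerSemicontinuousOn
        _)
  have hK : IsCompact (D ∩ Metric.closedBall z R) := by
    have := FiniteDimensional.proper ℝ X
    exact (isCompact_closedBall z R).inter_left hD
  have hne : (D ∩ Metric.closedBall z R).Nonempty := ⟨u₀, hu₀, hbound u₀ hu₀ le_rfl⟩
  obtain ⟨p, hp, hpm⟩ := hlsc.exists_isMinOn hne hK
  replace hpm : ∀ u ∈ D ∩ Metric.closedBall z R, f p + ‖p - z‖ ^ 2 / 2 ≤ f u + ‖u - z‖ ^ 2 / 2 :=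
    fun u hu => hpm hu
  refine ⟨p, hp.1, fun u hu => ?_⟩
  by_cases huM : f u + ‖u - z‖ ^ 2 / 2 ≤ M
  · exact hpm u ⟨hu, hbound u hu huM⟩
  · exact (hpm u₀ ⟨hu₀, hbound u₀ hu₀ le_rfl⟩).trans (not_le.1 huM).le

/-- First-order optimality: comparing p with (1-t)p + tu, using convexity and dividing by t leaves
an error t‖u-p‖²/2, which is made arbitrarily small. -/
theorem prox_real_ineq {D : Set X} {f : X → ℝ} (hf : ConvexOn ℝ D f) {p z : X} (hp : p ∈ D)
    (hmin : ∀ u ∈ D, f p + ‖p - z‖ ^ 2 / 2 ≤ f u + ‖u - z‖ ^ 2 / 2) {u : X} (hu : u ∈ D) :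
    f p - f u ≤ inner ℝ (p - z) (u - p) := by
  set N := ‖u - p‖ ^ 2
  have hN : 0 ≤ N := by positivity
  have key : ∀ t : ℝ, 0 < t → t ≤ 1 → f p - f u - inner ℝ (p - z) (u - p) ≤ t * N / 2 := by
    intro t ht ht1
    have hmem := hf.1 hp hu (by linarith : 0 ≤ 1 - t) ht.le (by ring)
    have h1 := hmin _ hmem
    have h2 := hf.2 hp hu (by linarith : 0 ≤ 1 - t) ht.le (by ring)
    have h3 : (1 - t) • p + t • u - z = (p - z) + t • (u - p) := by module
    have h4 : ‖(1 - t) • p + t • u - z‖ ^ 2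
        = ‖p - z‖ ^ 2 + 2 * (t * inner ℝ (p - z) (u - p)) + t ^ 2 * N := by
      rw [h3, norm_add_sq_real, inner_smul_right, norm_smul, mul_pow, Real.norm_eq_abs, sq_abs]
    simp only [smul_eq_mul] at h2
    rw [h4] at h1
    have h5 : t * (f p - f u - inner ℝ (p - z) (u - p)) ≤ t * (t * N / 2) := by nlinarith
    exact le_of_mul_le_mul_left h5 ht
  by_contra hlt
  push Not at hlt
  set δ := f p - f u - inner ℝ (p - z) (u - p)
  have hδ : 0 < δ := by simp only [δ]; linarith
  -- This t lies in (0, 1] and makes tN/2 < δ, which contradicts the bound; it also covers N = 0.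
  have h1 := key (δ / (δ + N)) (by positivity) (by rw [div_le_one (by positivity)]; linarith)
  have h2 : δ / (δ + N) * N / 2 < δ := by
    rw [div_mul_eq_mul_div, div_div, div_lt_iff₀ (by positivity)]
    nlinarith [mul_nonneg hδ.le hN, mul_pos hδ hδ]
  linarith

/-- A proximal point stays in the domain, and satisfies the variational inequality of the
minimization problem that defines it. -/
theorem prox_spec [FiniteDimensional ℝ X] {ψ : X → EReal} {D : Set X} (hD : IsClosed D)
    (hne : D.Nonempty) {f : X → ℝ} (hψ : ∀ u ∈ D, ψ u = (f u : EReal)) (hψ' : ∀ u ∉ D, ψ u = ⊤)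
    (hf : LowerSemicontinuousOn f D) (hfc : ConvexOn ℝ D f) {v : X} {c : ℝ}
    (hmin : ∀ u ∈ D, c + inner ℝ v u ≤ f u) (z : X) :
    prox ψ z ∈ D ∧ ∀ u ∈ D, f (prox ψ z) - f u ≤ inner ℝ (prox ψ z - z) (u - prox ψ z) := by
  have hex : ∃ p, ∀ u, ψ p + ((‖p - z‖ ^ 2 / 2 : ℝ) : EReal) ≤
      ψ u + ((‖u - z‖ ^ 2 / 2 : ℝ) : EReal) := by
    obtain ⟨p, hp, hpm⟩ := exists_prox_real hD hne hf hmin z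
    refine ⟨p, fun u => ?_⟩
    by_cases hu : u ∈ D
    · rw [hψ p hp, hψ u hu]; exact_mod_cast hpm u hu
    · rw [hψ' u hu, EReal.top_add_coe]; exact le_top
  have hspec := Classical.epsilon_spec hex
  change ∀ u, ψ (prox ψ z) + ((‖prox ψ z - z‖ ^ 2 / 2 : ℝ) : EReal) ≤
      ψ u + ((‖u - z‖ ^ 2 / 2 : ℝ) : EReal) at hspec
  have hmem : prox ψ z ∈ D := by
    by_contra hn
    obtain ⟨u, hu⟩ := hne
    have h := hspec u
    rw [hψ' _ hn, hψ u hu, EReal.top_add_coe, top_le_iff, ← EReal.coe_add] at h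
    exact EReal.coe_ne_top _ h
  refine ⟨hmem, fun u hu => prox_real_ineq hfc hmem (fun u hu => ?_) hu⟩
  have h := hspec u
  rw [hψ _ hmem, hψ u hu] at h
  exact_mod_cast h

end Convex

/-! ### Optimality conditions, multipliers and the regularized proximal problem -/

namespace Problem

variable {X A : Type*} [NormedAddCommGroup X] [InnerProductSpace ℝ X] [Fintype A]
  {P : Problem X A}

theorem lower_vi (hP : P.Standing) {z : X} (hz : z ∈ P.S₂) :
    z ∈ dom P.g₂ ∧
      ∀ y ∈ dom P.g₂, 0 ≤ inner ℝ (P.F₂ z) (y - z) + (P.g₂ y).toReal - (P.g₂ z).toReal := by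
  obtain ⟨a, ha, v, hv, hav⟩ := Set.mem_add.1 (show (0 : X) ∈ {P.F₂ z} + subdiff P.g₂ z from hz)
  rw [Set.mem_singleton_iff] at ha
  subst ha
  have hv' : v = -P.F₂ z := by rw [add_comm] at hav; exact eq_neg_of_add_eq_zero_left hav
  obtain ⟨h1, h2⟩ := hP.g₂_pcl.subdiff_ineq hv
  refine ⟨h1, fun y hy => ?_⟩
  have h3 := h2 y hy
  rw [hv', inner_neg_left] at h3
  linarith

theorem S₁_subset_dom {x : X} (hx : x ∈ P.S₁) : x ∈ dom P.g₁ := by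
  by_contra h
  -- Testing the inequality at the point itself: if g₁ is infinite there, the bifunction is ⊤ - ⊤ =
  -- ⊥ and cannot be nonnegative.
  have h1 := hx.2 x hx.1
  have h2 : P.g₁ x = ⊤ := not_lt_top_iff.1 h
  rw [bifun, h2] at h1
  simp at h1

theorem S₁_subset (hP : P.Standing) {x : X} (hx : x ∈ P.S₁) : x ∈ dom P.g₁ ∩ dom P.g₂ :=
  ⟨S₁_subset_dom hx, (lower_vi hP hx.1).1⟩

theorem multipliers_nonempty (hCQ : P.CQ) {x : X} (hx : x ∈ P.S₁) : (P.multipliers x).Nonempty := by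
  have hx' : (0 : X) ∈ {P.F₁ x} + subdiff P.g₁ x + normalCone P.S₂ x := by
    have h : P.S₁ = _ := hCQ
    rw [h] at hx
    exact hx
  obtain ⟨s, hs, p, hp, hsp⟩ := Set.mem_add.1 hx'
  obtain ⟨a, ha, v, hv, hav⟩ := Set.mem_add.1 hs
  rw [Set.mem_singleton_iff] at ha
  subst ha
  refine ⟨p, hp, ?_⟩
  have : -P.F₁ x - p = v := by
    rw [← hav] at hsp
    rw [sub_eq_iff_eq_add, neg_eq_iff_add_eq_zero, ← add_assoc]
    exact hsp
  rw [this]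
  exact hv

/-- A multiplier at `x` bounds the upper-level bifunction from below. -/
theorem multiplier_ineq (hP : P.Standing) {x p : X} (hp : p ∈ P.multipliers x) {y : X}
    (hy : y ∈ dom P.g₁) :
    -inner ℝ p (y - x) ≤ inner ℝ (P.F₁ x) (y - x) + (P.g₁ y).toReal - (P.g₁ x).toReal := by
  have h := (hP.g₁_pcl.subdiff_ineq hp.2).2 y hy
  rw [inner_sub_left, inner_neg_left] at h
  linarith

/-- The Attouch-Czarnecki number `h_k` bounds the lower-level Minty gap, tilted by `β_k p`. -/
theorem neg_h_le (hP : P.Standing) {b : ℝ} {x p : X} (hp : p ∈ P.multipliers x)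
    (hb : 0 ≤ b) (hh : (P.h b p).toENNReal ≠ ⊤) {y : X} (hy : y ∈ dom P.g₂) :
    -(P.h b p).toENNReal.toReal ≤
      inner ℝ (P.F₂ y) (y - x) + (P.g₂ y).toReal - (P.g₂ x).toReal - b * inner ℝ p (y - x) := by
  have hxS : x ∈ P.S₂ := hp.1.1
  have hx := (lower_vi hP hxS).1
  -- A normal vector attains its support function at the base point, so the supremum becomes a real
  -- number and can be subtracted safely.
  have hsupp : supp (b • p) P.S₂ = ((inner ℝ (b • p) x : ℝ) : EReal) := by
    apply le_antisymm
    · refine iSup₂_le fun z hz => EReal.coe_le_coe_iff.2 ?_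
      have := hp.1.2 z hz
      rw [inner_smul_left, inner_smul_left]
      rw [inner_sub_right] at this
      exact mul_le_mul_of_nonneg_left (by linarith) hb
    · exact le_iSup₂ (f := fun z (_ : z ∈ P.S₂) => ((inner ℝ (b • p) z : ℝ) : EReal)) x hxS
  have h1 : bifun P.F₂ P.g₂ x y + ((inner ℝ y (b • p) : ℝ) : EReal) ≤
      ⨆ z ∈ P.S₂, phi P.F₂ P.g₂ z (b • p) :=
    (le_iSup₂ (f := fun y (_ : y ∈ dom P.g₂) =>
      (bifun P.F₂ P.g₂ x y + ((inner ℝ y (b • p) : ℝ) : EReal))) y hy).trans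
      (le_iSup₂ (f := fun z (_ : z ∈ P.S₂) => phi P.F₂ P.g₂ z (b • p)) x hxS)
  rw [hP.g₂_pcl.bifun_eq P.F₂ hx hy, ← EReal.coe_add] at h1
  have h2 : (((inner ℝ (P.F₂ y) (x - y) + (P.g₂ x).toReal - (P.g₂ y).toReal + inner ℝ y (b • p))
      - inner ℝ (b • p) x : ℝ) : EReal) ≤ P.h b p := by
    rw [Problem.h, hsupp, EReal.coe_sub]
    exact EReal.sub_le_sub h1 le_rfl
  have h3 := h2.trans (EReal.coe_toENNReal_eq_max.symm ▸ le_max_right _ _)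
  rw [← ENNReal.ofReal_toReal hh, EReal.coe_ennreal_ofReal, max_eq_left ENNReal.toReal_nonneg,
    EReal.coe_le_coe_iff] at h3
  rw [real_inner_comm (b • p) y, inner_smul_left, inner_smul_left, ← neg_sub y x,
    inner_neg_right] at h3
  rw [inner_sub_right p]
  simp only [conj_trivial] at h3
  linarith

theorem G_eq (hP : P.Standing) {t b : ℝ} {u : X} (hu : u ∈ dom P.g₁ ∩ dom P.g₂) :
    (t : EReal) * P.G b u = ((t * (b * (P.g₁ u).toReal + (P.g₂ u).toReal) : ℝ) : EReal) := by
  rw [Problem.G, ← hP.g₁_pcl.coe_toReal hu.1, ← hP.g₂_pcl.coe_toReal hu.2]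
  simp

theorem G_eq_top (hP : P.Standing) {t b : ℝ} (ht : 0 < t) (hb : 0 < b) {u : X}
    (hu : u ∉ dom P.g₁ ∩ dom P.g₂) : (t : EReal) * P.G b u = ⊤ := by
  have h : P.G b u = ⊤ := by
    rw [Problem.G]
    by_cases h1 : u ∈ dom P.g₁
    · have h2 : u ∉ dom P.g₂ := fun h2 => hu ⟨h1, h2⟩
      rw [hP.g₂_pcl.eq_top h2, ← hP.g₁_pcl.coe_toReal h1, ← EReal.coe_mul, EReal.coe_add_top]
    · rw [hP.g₁_pcl.eq_top h1, EReal.coe_mul_top_of_pos hb]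
      exact EReal.top_add_of_ne_bot (hP.g₂_pcl.ne_bot u)
  rw [h, EReal.coe_mul_top_of_pos ht]

/-- The affine minorant required for existence comes from any solution x with a multiplier p:
-(F₁(x) + p) is a subgradient of g₁ at x and -F₂(x) one of g₂, and these are combined with weights
tb and t. -/
theorem prox_vi [FiniteDimensional ℝ X] (hP : P.Standing) (hvar : P.FiniteVariation) (hCQ : P.CQ)
    {t b : ℝ} (ht : 0 < t) (hb : 0 < b) (z : X) :
    prox (fun u => (t : EReal) * P.G b u) z ∈ dom P.g₁ ∩ dom P.g₂ ∧
      ∀ u ∈ dom P.g₁ ∩ dom P.g₂,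
        t * (b * (P.g₁ (prox (fun u => (t : EReal) * P.G b u) z)).toReal +
            (P.g₂ (prox (fun u => (t : EReal) * P.G b u) z)).toReal)
          - t * (b * (P.g₁ u).toReal + (P.g₂ u).toReal) ≤
        inner ℝ (prox (fun u => (t : EReal) * P.G b u) z - z)
          (u - prox (fun u => (t : EReal) * P.G b u) z) := by
  obtain ⟨x, hx⟩ := hP.sol
  obtain ⟨p, hp⟩ := multipliers_nonempty hCQ hx
  have hconv : Convex ℝ (dom P.g₁ ∩ dom P.g₂) := hP.g₁_pcl.convexOn.1.inter hP.g₂_pcl.convexOn.1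
  refine prox_spec (f := fun u => t * (b * (P.g₁ u).toReal + (P.g₂ u).toReal)) hvar.closed
    ⟨x, S₁_subset hP hx⟩ (fun u hu => G_eq hP hu) (fun u hu => G_eq_top hP ht hb hu) ?_ ?_
    (v := -(t • (b • (P.F₁ x + p) + P.F₂ x)))
    (c := t * (b * ((P.g₁ x).toReal + inner ℝ (P.F₁ x + p) x) +
      ((P.g₂ x).toReal + inner ℝ (P.F₂ x) x))) ?_ z
  · have h1 := hP.g₁_pcl.lowerSemicontinuousOn.mono (Set.inter_subset_left (t := dom P.g₂))
    have h2 := hP.g₂_pcl.lowerSemicontinuousOn.mono (Set.inter_subset_right (s := dom P.g₁))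
    have hm : ∀ s : ℝ, 0 < s → Monotone fun r : ℝ => s * r :=
      fun s hs r r' hr => mul_le_mul_of_nonneg_left hr hs.le
    have h3 := (continuous_const_mul b).comp_lowerSemicontinuousOn h1 (hm b hb)
    exact (continuous_const_mul t).comp_lowerSemicontinuousOn (h3.add h2) (hm t ht)
  · have h1 := hP.g₁_pcl.convexOn.subset (Set.inter_subset_left (t := dom P.g₂)) hconv
    have h2 := hP.g₂_pcl.convexOn.subset (Set.inter_subset_right (s := dom P.g₁)) hconv
    exact ((h1.smul hb.le).add h2).smul ht.le
  · intro u hu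
    have h1 := multiplier_ineq hP hp hu.1
    have h2 := (lower_vi hP hx.1).2 u hu.2
    rw [inner_neg_left]
    simp only [inner_smul_left, inner_add_left, inner_sub_right, conj_trivial] at *
    have h3 : b * ((P.g₁ x).toReal + (inner ℝ (P.F₁ x) x + inner ℝ p x)) +
      ((P.g₂ x).toReal + inner ℝ (P.F₂ x) x) - (b * (inner ℝ (P.F₁ x) u + inner ℝ p u) +
        inner ℝ (P.F₂ x) u) ≤ b * (P.g₁ u).toReal + (P.g₂ u).toReal := by nlinarith
    nlinarith [mul_le_mul_of_nonneg_left h3 ht.le]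

end Problem

/-- Points that satisfy the variational inequalities of a common convex problem are at most as
far apart as their data. -/
theorem norm_sub_le_of_vi {X : Type*} [NormedAddCommGroup X] [InnerProductSpace ℝ X] {a b : ℝ}
    {p p' z z' : X} (h : a - b ≤ inner ℝ (p - z) (p' - p)) (h' : b - a ≤ inner ℝ (p' - z') (p - p')) :
    ‖p - p'‖ ≤ ‖z - z'‖ := by
  have h1 : ‖p - p'‖ ^ 2 ≤ inner ℝ (z - z') (p - p') := by
    rw [← real_inner_self_eq_norm_sq]
    simp only [inner_sub_left, inner_sub_right] at *
    rw [real_inner_comm p p'] at *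
    linarith
  have h2 := h1.trans (real_inner_le_norm _ _)
  by_contra hlt
  push Not at hlt
  nlinarith [norm_nonneg (z - z'), norm_nonneg (p - p')]

/-- One step of the extragradient method with two proximal steps from the center
`(1 - θ) x + θ w`. -/
theorem extragradient_step {X : Type*} [NormedAddCommGroup X] [InnerProductSpace ℝ X]
    {θ t a a' e : ℝ} {x w y x' u v d z : X} (hz : z = (1 - θ) • x + θ • w)
    (hy : a - a' ≤ inner ℝ (y - (z - t • v)) (x' - y))
    (hx : a' - e ≤ inner ℝ (x' - (z - t • (v + d))) (u - x')) :
    2 * (a - e) + 2 * t * inner ℝ (v + d) (y - u) + ‖x' - u‖ ^ 2 ≤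
      (1 - θ) * ‖x - u‖ ^ 2 + θ * ‖w - u‖ ^ 2 - (1 - θ) * ‖y - x‖ ^ 2 - θ * ‖y - w‖ ^ 2
        - ‖x' - y‖ ^ 2 - 2 * t * inner ℝ d (x' - y) := by
  subst hz
  simp only [← real_inner_self_eq_norm_sq]
  simp only [inner_sub_left, inner_sub_right, inner_add_left, inner_smul_left, conj_trivial] at *
  rw [real_inner_comm x u, real_inner_comm w u, real_inner_comm x' u, real_inner_comm y x,
    real_inner_comm y w, real_inner_comm x' y] at *
  linarith

/-! ### The filtration of samples and coin tosses -/

section Past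

variable {Ω Ξ : Type*} [MeasurableSpace Ξ] {ξ : ℕ → Ω → Ξ} {b : ℕ → Ω → Bool}

/-- The information revealed by the samples and coin tosses before step `k`. -/
@[reducible] def past (ξ : ℕ → Ω → Ξ) (b : ℕ → Ω → Bool) (k : ℕ) : MeasurableSpace Ω :=
  ⨆ j ∈ Set.Iio k, MeasurableSpace.comap (fun ω => (ξ j ω, b j ω)) inferInstance

theorem past_mono {j k : ℕ} (h : j ≤ k) : past ξ b j ≤ past ξ b k :=
  biSup_mono fun _ hi => lt_of_lt_of_le hi h

theorem measurable_noise (k : ℕ) : Measurable[past ξ b (k + 1)] fun ω => (ξ k ω, b k ω) := by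
  rw [measurable_iff_comap_le]
  exact le_iSup₂ (f := fun j (_ : j ∈ Set.Iio (k + 1)) =>
    MeasurableSpace.comap (fun ω => (ξ j ω, b j ω)) inferInstance) k (Nat.lt_succ_self k)

/-- The information revealed before the coin toss of step `k`. -/
@[reducible] def half (ξ : ℕ → Ω → Ξ) (b : ℕ → Ω → Bool) (k : ℕ) : MeasurableSpace Ω :=
  past ξ b k ⊔ MeasurableSpace.comap (ξ k) inferInstance

theorem past_le_half (k : ℕ) : past ξ b k ≤ half ξ b k := le_sup_left

theorem measurable_sample_half (k : ℕ) : Measurable[half ξ b k] (ξ k) :=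
  measurable_iff_comap_le.2 le_sup_right

end Past

/-! ### Independence of the noise from the past -/

section Noise

variable {Ω Ξ S : Type*} [mΩ : MeasurableSpace Ω] [MeasurableSpace Ξ] [MeasurableSpace S]
  {μ : Measure Ω} {Q : Measure Ξ} {θ : ℝ} {ξ : ℕ → Ω → Ξ} {b : ℕ → Ω → Bool}

/-- The centered coin toss. -/
noncomputable def coin (θ : ℝ) (b : ℕ → Ω → Bool) (k : ℕ) (ω : Ω) : ℝ :=
  (if b k ω then 1 else 0) - θ

/-- The law of (Z, (f, g)) is a threefold product, and reassociating that product regroups it as the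
law of ((Z, f), g). -/
theorem IndepFun.prod_left {E₁ E₂ : Type*} [MeasurableSpace E₁] [MeasurableSpace E₂]
    [IsProbabilityMeasure μ] {Z : Ω → S} {f : Ω → E₁} {g : Ω → E₂} (hZ : Measurable Z)
    (hf : Measurable f) (hg : Measurable g) (h : IndepFun Z (fun ω => (f ω, g ω)) μ)
    (hfg : IndepFun f g μ) : IndepFun (fun ω => (Z ω, f ω)) g μ := by
  have := Measure.isProbabilityMeasure_map (μ := μ) hZ.aemeasurable
  have := Measure.isProbabilityMeasure_map (μ := μ) hf.aemeasurable
  have := Measure.isProbabilityMeasure_map (μ := μ) hg.aemeasurable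
  have hZf : IndepFun Z f μ := h.comp (φ := id) (ψ := Prod.fst) measurable_id measurable_fst
  rw [indepFun_iff_map_prod_eq_prod_map_map (hZ.prodMk hf).aemeasurable hg.aemeasurable,
    hZf.map_prod_eq_prod_map_map hZ.aemeasurable hf.aemeasurable]
  apply (MeasurableEquiv.map_measurableEquiv_injective MeasurableEquiv.prodAssoc)
  rw [Measure.prodAssoc_prod, ← hfg.map_prod_eq_prod_map_map hf.aemeasurable hg.aemeasurable,
    ← h.map_prod_eq_prod_map_map hZ.aemeasurable (hf.prodMk hg).aemeasurable,
    Measure.map_map MeasurableEquiv.prodAssoc.measurable ((hZ.prodMk hf).prodMk hg)]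
  rfl

namespace Sampling

theorem noise_measurable (hS : Sampling μ Q θ ξ b) (k : ℕ) :
    Measurable fun ω => (ξ k ω, b k ω) :=
  (hS.meas_ξ k).prodMk (hS.meas_b k)

theorem past_le (hS : Sampling μ Q θ ξ b) (k : ℕ) : past ξ b k ≤ mΩ :=
  iSup₂_le fun j _ => (hS.noise_measurable j).comap_le

theorem indep_past (hS : Sampling μ Q θ ξ b) {k : ℕ} {Z : Ω → S} (hZ : Measurable[past ξ b k] Z) :
    IndepFun Z (fun ω => (ξ k ω, b k ω)) μ := by
  have h := indep_iSup_of_disjoint (fun i => (hS.noise_measurable i).comap_le)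
    ((iIndepFun_iff_iIndep _ _ _).1 hS.indep) (S := Set.Iio k) (T := {k}) (by simp)
  rw [IndepFun_iff_Indep]
  refine indep_of_indep_of_le_right (indep_of_indep_of_le_left h hZ.comap_le) ?_
  exact le_iSup₂ (f := fun j (_ : j ∈ ({k} : Set ℕ)) =>
    MeasurableSpace.comap (fun ω => (ξ j ω, b j ω)) inferInstance) k rfl

theorem map_sample [IsProbabilityMeasure μ] (hS : Sampling μ Q θ ξ b) {k : ℕ} {Z : Ω → S}
    (hZ : Measurable[past ξ b k] Z) :
    μ.map (fun ω => (Z ω, ξ k ω)) = (μ.map Z).prod Q := by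
  have h : IndepFun Z (ξ k) μ :=
    (hS.indep_past hZ).comp (φ := id) (ψ := Prod.fst) measurable_id measurable_fst
  rw [h.map_prod_eq_prod_map_map (hZ.mono (hS.past_le k) le_rfl).aemeasurable
    (hS.meas_ξ k).aemeasurable, hS.law_ξ]

/-- Independence factors the joint law of Z and the sample, and Fubini integrates the sample first
with Z frozen. This replaces a conditional expectation. -/
theorem integral_sample_eq_zero [IsProbabilityMeasure μ] [SFinite Q] (hS : Sampling μ Q θ ξ b)
    {k : ℕ} {Z : Ω → S} (hZ : Measurable[past ξ b k] Z) {f : S → Ξ → ℝ}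
    (hf : Measurable (Function.uncurry f)) (h0 : ∀ z, ∫ s, f z s ∂Q = 0)
    (hi : Integrable (fun ω => f (Z ω) (ξ k ω)) μ) : ∫ ω, f (Z ω) (ξ k ω) ∂μ = 0 := by
  have hm : Measurable fun ω => (Z ω, ξ k ω) :=
    (hZ.mono (hS.past_le k) le_rfl).prodMk (hS.meas_ξ k)
  have h1 := integral_map (μ := μ) hm.aemeasurable
    (hf.aestronglyMeasurable (μ := μ.map fun ω => (Z ω, ξ k ω)))
  have h2 := (integrable_map_measure
    (hf.aestronglyMeasurable (μ := μ.map fun ω => (Z ω, ξ k ω))) hm.aemeasurable).2 hi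
  rw [hS.map_sample hZ] at h1 h2
  rw [integral_prod _ h2] at h1
  simpa [Function.uncurry, h0] using h1.symm

/-- The Tonelli form needs no integrability, so it can be used to prove that second moments are
finite. -/
theorem lintegral_sample [IsProbabilityMeasure μ] [SFinite Q] (hS : Sampling μ Q θ ξ b)
    {k : ℕ} {Z : Ω → S} (hZ : Measurable[past ξ b k] Z) {f : S → Ξ → ℝ≥0∞}
    (hf : Measurable (Function.uncurry f)) :
    ∫⁻ ω, f (Z ω) (ξ k ω) ∂μ = ∫⁻ ω, ∫⁻ s, f (Z ω) s ∂Q ∂μ := by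
  have hZ' : Measurable Z := hZ.mono (hS.past_le k) le_rfl
  have h1 := lintegral_map (μ := μ) hf (hZ'.prodMk (hS.meas_ξ k))
  rw [hS.map_sample hZ, lintegral_prod _ hf.aemeasurable,
    lintegral_map hf.lintegral_prod_right' hZ'] at h1
  exact h1.symm

theorem measurable_coin (hS : Sampling μ Q θ ξ b) (k : ℕ) : Measurable (coin θ b k) :=
  ((measurable_of_countable fun c : Bool => ((if c then 1 else 0) - θ : ℝ)).comp (hS.meas_b k))

theorem half_le (hS : Sampling μ Q θ ξ b) (k : ℕ) : half ξ b k ≤ mΩ :=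
  sup_le (hS.past_le k) (hS.meas_ξ k).comap_le

/-- The pair (sample, coin) is independent of the past and its two components are independent of
each other; regrouping separates the coin from past and sample together. -/
theorem indep_coin [IsProbabilityMeasure μ] (hS : Sampling μ Q θ ξ b) {k : ℕ} {W : Ω → ℝ}
    (hW : Measurable[half ξ b k] W) {φ : Bool → ℝ} : IndepFun (fun ω => φ (b k ω)) W μ := by
  -- Taking Z to be the identity into Ω with the past σ-algebra makes (Z, ξ_k) generate exactly
  -- `half ξ b k`.
  have h1 := @IndepFun.prod_left Ω Ω mΩ (past ξ b k) μ Ξ Bool _ _ _ id (ξ k) (b k)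
    (measurable_id'' (hS.past_le k)) (hS.meas_ξ k) (hS.meas_b k)
    (@Sampling.indep_past Ω Ξ Ω mΩ _ (past ξ b k) μ Q θ ξ b hS k id
      (@measurable_id Ω (past ξ b k))) (hS.indep_pair k)
  have h2 : Indep (half ξ b k) (MeasurableSpace.comap (b k) inferInstance) μ := by
    have h := (@IndepFun_iff_Indep _ _ _ _ (@Prod.instMeasurableSpace _ _ (past ξ b k) _)
      _ _ _ _).1 h1
    have hc : (@Prod.instMeasurableSpace _ _ (past ξ b k) _).comap (fun ω => (id ω, ξ k ω)) =
        half ξ b k :=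
      (@MeasurableSpace.comap_prodMk _ _ _ (past ξ b k) _ id (ξ k)).trans
        (by rw [MeasurableSpace.comap_id])
    rwa [hc] at h
  rw [IndepFun_iff_Indep]
  refine (indep_of_indep_of_le_left (indep_of_indep_of_le_right h2 ?_) hW.comap_le).symm
  exact ((measurable_of_countable φ).comp (comap_measurable (b k))).comap_le

theorem integral_indicator_coin [IsProbabilityMeasure μ] (hS : Sampling μ Q θ ξ b) (hθ : 0 ≤ θ)
    (k : ℕ) : Integrable (fun ω => if b k ω then (1 : ℝ) else 0) μ ∧
      ∫ ω, (if b k ω then (1 : ℝ) else 0) ∂μ = θ := by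
  have hm : MeasurableSet {ω | b k ω = true} := hS.meas_b k (measurableSet_singleton true)
  have he : (fun ω => if b k ω then (1 : ℝ) else 0) = {ω | b k ω = true}.indicator fun _ => 1 := by
    funext ω
    simp [Set.indicator_apply]
  rw [he]
  refine ⟨(integrable_const 1).indicator hm, ?_⟩
  rw [integral_indicator_const _ hm, measureReal_def, hS.law_b, ENNReal.toReal_ofReal hθ]
  simp

theorem integral_coin [IsProbabilityMeasure μ] (hS : Sampling μ Q θ ξ b) (hθ : 0 ≤ θ)
    (k : ℕ) : ∫ ω, coin θ b k ω ∂μ = 0 := by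
  obtain ⟨h1, h2⟩ := hS.integral_indicator_coin hθ k
  simp only [coin]
  rw [integral_sub h1 (integrable_const θ), h2]
  simp

theorem integral_coin_sq [IsProbabilityMeasure μ] (hS : Sampling μ Q θ ξ b) (hθ : 0 ≤ θ)
    (k : ℕ) : ∫ ω, coin θ b k ω ^ 2 ∂μ = θ * (1 - θ) := by
  obtain ⟨h1, h2⟩ := hS.integral_indicator_coin hθ k
  have he : ∀ ω, coin θ b k ω ^ 2 = (1 - 2 * θ) * (if b k ω then (1 : ℝ) else 0) + θ ^ 2 := by
    intro ω
    simp only [coin]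
    split_ifs <;> ring
  simp only [he]
  rw [integral_add (h1.const_mul _) (integrable_const _), integral_const_mul, h2]
  simp
  ring

/-- A coin toss is centered given the past and the current sample. -/
theorem integral_coin_mul [IsProbabilityMeasure μ] (hS : Sampling μ Q θ ξ b) (hθ : 0 ≤ θ)
    {k : ℕ} {W : Ω → ℝ} (hW : Measurable[half ξ b k] W) :
    ∫ ω, coin θ b k ω * W ω ∂μ = 0 := by
  have h := (hS.indep_coin hW (φ := fun c => (if c then 1 else 0) - θ))
  have h2 := h.integral_fun_mul_eq_mul_integral (hS.measurable_coin k).aestronglyMeasurable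
    (hW.mono (hS.half_le k) le_rfl).aestronglyMeasurable
  rw [show (∫ ω, coin θ b k ω * W ω ∂μ) = _ from h2,
    show (∫ ω, (fun c => (if c then 1 else 0) - θ : Bool → ℝ) (b k ω) ∂μ) = 0 from
      hS.integral_coin hθ k, zero_mul]

theorem integral_coin_sq_mul [IsProbabilityMeasure μ] (hS : Sampling μ Q θ ξ b) (hθ : 0 ≤ θ)
    {k : ℕ} {W : Ω → ℝ} (hW : Measurable[half ξ b k] W) :
    ∫ ω, coin θ b k ω ^ 2 * W ω ∂μ = θ * (1 - θ) * ∫ ω, W ω ∂μ := by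
  have h := (hS.indep_coin hW (φ := fun c => ((if c then 1 else 0) - θ) ^ 2))
  have h2 := h.integral_fun_mul_eq_mul_integral
    ((hS.measurable_coin k).pow_const 2).aestronglyMeasurable
    (hW.mono (hS.half_le k) le_rfl).aestronglyMeasurable
  rw [show (∫ ω, coin θ b k ω ^ 2 * W ω ∂μ) = _ from h2,
    show (∫ ω, (fun c => ((if c then 1 else 0) - θ) ^ 2 : Bool → ℝ) (b k ω) ∂μ) = _ from
      hS.integral_coin_sq hθ k]

end Sampling

theorem memLp_inner {X : Type*} [NormedAddCommGroup X] [InnerProductSpace ℝ X] {f g : Ω → X}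
    (hf : MemLp f 2 μ) (hg : MemLp g 2 μ) : Integrable (fun ω => inner ℝ (f ω) (g ω)) μ := by
  refine ((hf.integrable_norm_pow two_ne_zero).add (hg.integrable_norm_pow two_ne_zero)).mono'
    (hf.1.inner hg.1) (Filter.Eventually.of_forall fun ω => ?_)
  have h1 := norm_inner_le_norm (𝕜 := ℝ) (f ω) (g ω)
  simp only [Pi.add_apply]
  nlinarith [sq_nonneg (‖f ω‖ - ‖g ω‖), sq_nonneg (‖f ω‖), sq_nonneg (‖g ω‖)]

end Noise

/-- A run of the algorithm on a hierarchical problem, with a reference solution `xs` and a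
multiplier `p` at that solution. -/
structure Run (X A Ξ Ω : Type*) [NormedAddCommGroup X] [InnerProductSpace ℝ X]
    [MeasurableSpace X] [Fintype A] [MeasurableSpace Ξ] [MeasurableSpace Ω] where
  P : Problem X A
  hP : P.Standing
  hvar : P.FiniteVariation
  hCQ : P.CQ
  θ : ℝ
  γ : ℝ
  hθ : 0 < θ
  hθ' : θ ≤ 1
  hγ : 0 < γ
  hγ' : γ < 1
  τ : ℕ → ℝ
  β : ℕ → ℝ
  ℒ : ℕ → ℝ
  hτ : ∀ k, 0 < τ k
  hβ : ∀ k, 0 < β k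
  hβ' : Antitone β
  Q : Measure Ξ
  hQ : IsProbabilityMeasure Q
  O : ℕ → Ξ → X → X
  hO : P.Oracle β Q O ℒ
  hτ' : ∀ k, τ k ≤ √θ / ℒ k * γ
  μ : Measure Ω
  hμ : IsProbabilityMeasure μ
  ξ : ℕ → Ω → Ξ
  b : ℕ → Ω → Bool
  hS : Sampling μ Q θ ξ b
  x₀ : X
  xs : X
  hxs : xs ∈ P.S₁
  p : X
  hp : p ∈ P.multipliers xs

/-! ### Notation for a run and the pathwise one-step inequality -/

namespace Run

attribute [instance] Run.hQ Run.hμ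

noncomputable section

variable {X A Ξ Ω : Type*} [NormedAddCommGroup X] [InnerProductSpace ℝ X]
  [MeasurableSpace X] [Fintype A] [MeasurableSpace Ξ] [MeasurableSpace Ω]

variable (R : Run X A Ξ Ω)

/-- The common domain. -/
def D : Set X := dom R.P.g₁ ∩ dom R.P.g₂

/-- Real-valued version of the upper-level function. -/
def f₁ (x : X) : ℝ := (R.P.g₁ x).toReal

/-- Real-valued version of the lower-level function. -/
def f₂ (x : X) : ℝ := (R.P.g₂ x).toReal

/-- Real-valued version of the upper-level bifunction. -/
def H₁ (x y : X) : ℝ := inner ℝ (R.P.F₁ y) (x - y) + R.f₁ x - R.f₁ y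

/-- Real-valued version of the lower-level bifunction. -/
def H₂ (x y : X) : ℝ := inner ℝ (R.P.F₂ y) (x - y) + R.f₂ x - R.f₂ y

/-- The bifunction of the regularized problem, with the operator evaluated at the first point. -/
def Γ (k : ℕ) (y u : X) : ℝ :=
  (R.β k * R.f₁ y + R.f₂ y) - (R.β k * R.f₁ u + R.f₂ u) + inner ℝ (R.P.V (R.β k) y) (y - u)

/-- The regularized proximal map. -/
def pr (k : ℕ) (z : X) : X := prox (fun u => (R.τ k : EReal) * R.P.G (R.β k) u) z

/-- The pair `(x_k, w_k)`. -/
def state (k : ℕ) (ω : Ω) : X × X :=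
  R.P.iterates (1 - R.θ) R.τ R.β R.O R.x₀ (fun k => R.ξ k ω) (fun k => R.b k ω) k

/-- The iterate `x_k`. -/
def x (k : ℕ) (ω : Ω) : X := (R.state k ω).1

/-- The snapshot `w_k`. -/
def w (k : ℕ) (ω : Ω) : X := (R.state k ω).2

/-- The iterate `y_{k+1}`. -/
def y (k : ℕ) (ω : Ω) : X := R.P.yStep (1 - R.θ) R.τ R.β k (R.x k ω) (R.w k ω)

/-- The prox center `z_k`. -/
def z (k : ℕ) (ω : Ω) : X := (1 - R.θ) • R.x k ω + R.θ • R.w k ω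

/-- The sampled difference of operator values. -/
def d (k : ℕ) (ω : Ω) : X := R.O k (R.ξ k ω) (R.y k ω) - R.O k (R.ξ k ω) (R.w k ω)

/-- The exact difference of operator values. -/
def m (k : ℕ) (ω : Ω) : X := R.P.V (R.β k) (R.y k ω) - R.P.V (R.β k) (R.w k ω)

/-- The centered coin toss at step `k`. -/
def c (k : ℕ) (ω : Ω) : ℝ := coin R.θ R.b k ω

/-- The Lyapunov function. -/
def Φ (k : ℕ) (ω : Ω) (u : X) : ℝ := (1 - R.θ) * ‖R.x k ω - u‖ ^ 2 + ‖R.w k ω - u‖ ^ 2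

/-- The decrease of the Lyapunov function. -/
def a (k : ℕ) (ω : Ω) : ℝ :=
  R.θ * ‖R.y k ω - R.w k ω‖ ^ 2 + ‖R.x (k + 1) ω - R.y k ω‖ ^ 2

/-- The excess of the squared sampling error. -/
def q (k : ℕ) (ω : Ω) : ℝ :=
  R.τ k ^ 2 / R.γ * ‖R.d k ω‖ ^ 2 - R.γ * R.θ * ‖R.y k ω - R.w k ω‖ ^ 2

/-- The scalar noise term. -/
def n (k : ℕ) (ω : Ω) : ℝ :=
  -(2 * R.τ k * inner ℝ (R.d k ω - R.m k ω) (R.y k ω - R.x₀)) +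
    R.c k ω * (‖R.x (k + 1) ω - R.x₀‖ ^ 2 - ‖R.w k ω - R.x₀‖ ^ 2)

/-- The vectorial noise term. -/
def r (k : ℕ) (ω : Ω) : X :=
  (2 * R.τ k) • (R.d k ω - R.m k ω) - (2 * R.c k ω) • (R.x (k + 1) ω - R.w k ω)

theorem x_zero (ω : Ω) : R.x 0 ω = R.x₀ := rfl

theorem w_zero (ω : Ω) : R.w 0 ω = R.x₀ := rfl

theorem y_eq (k : ℕ) (ω : Ω) :
    R.y k ω = R.pr k (R.z k ω - R.τ k • R.P.V (R.β k) (R.w k ω)) := by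
  simp [y, Problem.yStep, pr, z]

theorem x_succ (k : ℕ) (ω : Ω) :
    R.x (k + 1) ω = R.pr k (R.z k ω - R.τ k • (R.P.V (R.β k) (R.w k ω) + R.d k ω)) := by
  simp only [x, state, Problem.iterates, Problem.xStep, pr, z, d, y, w, sub_sub_cancel,
    add_sub_assoc]

theorem w_succ (k : ℕ) (ω : Ω) :
    R.w (k + 1) ω = if R.b k ω then R.x (k + 1) ω else R.w k ω := rfl

theorem xs_mem : R.xs ∈ R.D := Problem.S₁_subset R.hP R.hxs

theorem D_convex : Convex ℝ R.D := R.hP.g₁_pcl.convexOn.1.inter R.hP.g₂_pcl.convexOn.1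

theorem f₁_convex : ConvexOn ℝ R.D R.f₁ :=
  R.hP.g₁_pcl.convexOn.subset Set.inter_subset_left R.D_convex

theorem f₂_convex : ConvexOn ℝ R.D R.f₂ :=
  R.hP.g₂_pcl.convexOn.subset Set.inter_subset_right R.D_convex

theorem H₂_nonneg {y u : X} (hy : y ∈ R.D) (hu : u ∈ R.P.S₂) : 0 ≤ R.H₂ y u :=
  (Problem.lower_vi R.hP hu).2 y hy.2

theorem H₁_ge {y : X} (hy : y ∈ R.D) : -inner ℝ R.p (y - R.xs) ≤ R.H₁ y R.xs :=
  Problem.multiplier_ineq R.hP R.hp hy.1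

/-- Monotonicity of both operators moves their evaluation from y to u, where the bifunctions are
convex in y and Jensen applies. -/
theorem Γ_ge (k : ℕ) (y u : X) : R.β k * R.H₁ y u + R.H₂ y u ≤ R.Γ k y u := by
  have h1 := mul_nonneg (R.hβ k).le (R.hP.F₁_mono y u)
  have h2 := R.hP.F₂_mono y u
  simp only [H₁, H₂, Γ, Problem.V, inner_add_left, inner_smul_left, conj_trivial]
  rw [inner_sub_left] at h1 h2
  linarith

/-- The real number `h_k`. -/
def hk (k : ℕ) : ℝ := (R.P.h (R.β k) R.p).toENNReal.toReal

/-- The term -β_k⟨p, y - x*⟩ in the lower-level bound of `neg_h_le` is compensated by the multiplier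
inequality for the upper level. Only F₁ has to be moved by monotonicity, since φ already evaluates
F₂ at y. -/
theorem neg_hk_le {k : ℕ} (hk : (R.P.h (R.β k) R.p).toENNReal ≠ ⊤) {y : X} (hy : y ∈ R.D) :
    -R.hk k ≤ R.Γ k y R.xs := by
  have h1 := Problem.neg_h_le R.hP R.hp (R.hβ k).le hk hy.2
  have h2 := mul_le_mul_of_nonneg_left (R.H₁_ge hy) (R.hβ k).le
  have h3 := mul_nonneg (R.hβ k).le (R.hP.F₁_mono y R.xs)
  simp only [Run.hk]
  simp only [H₁, Γ, Problem.V, inner_add_left, inner_smul_left, conj_trivial, f₁, f₂] at *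
  rw [inner_sub_left] at h3
  linarith

variable [FiniteDimensional ℝ X]

theorem pr_mem (k : ℕ) (z : X) : R.pr k z ∈ R.D :=
  (Problem.prox_vi R.hP R.hvar R.hCQ (R.hτ k) (R.hβ k) z).1

theorem pr_vi (k : ℕ) (z : X) {u : X} (hu : u ∈ R.D) :
    R.τ k * (R.β k * R.f₁ (R.pr k z) + R.f₂ (R.pr k z)) -
      R.τ k * (R.β k * R.f₁ u + R.f₂ u) ≤ inner ℝ (R.pr k z - z) (u - R.pr k z) :=
  (Problem.prox_vi R.hP R.hvar R.hCQ (R.hτ k) (R.hβ k) z).2 u hu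

theorem pr_lipschitz (k : ℕ) (z z' : X) : ‖R.pr k z - R.pr k z'‖ ≤ ‖z - z'‖ :=
  norm_sub_le_of_vi (R.pr_vi k z (R.pr_mem k z')) (R.pr_vi k z' (R.pr_mem k z))

theorem pr_continuous (k : ℕ) : Continuous (R.pr k) :=
  (LipschitzWith.of_dist_le_mul (K := 1) fun z z' => by
    simpa [dist_eq_norm] using R.pr_lipschitz k z z').continuous

theorem y_mem (k : ℕ) (ω : Ω) : R.y k ω ∈ R.D := R.y_eq k ω ▸ R.pr_mem k _

theorem x_succ_mem (k : ℕ) (ω : Ω) : R.x (k + 1) ω ∈ R.D := R.x_succ k ω ▸ R.pr_mem k _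

/-- The pathwise one-step inequality, with all noise terms split off. -/
theorem step (k : ℕ) (ω : Ω) {u : X} (hu : u ∈ R.D) :
    2 * R.τ k * R.Γ k (R.y k ω) u + R.Φ (k + 1) ω u ≤
      R.Φ k ω u - (1 - R.γ) * R.a k ω + R.q k ω + R.n k ω + inner ℝ (R.r k ω) (u - R.x₀) := by
  have hy := R.pr_vi k (R.z k ω - R.τ k • R.P.V (R.β k) (R.w k ω)) (R.x_succ_mem k ω)
  have hx := R.pr_vi k (R.z k ω - R.τ k • (R.P.V (R.β k) (R.w k ω) + R.d k ω)) hu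
  rw [← R.y_eq] at hy
  rw [← R.x_succ] at hx
  have h := extragradient_step (x := R.x k ω) (w := R.w k ω) (θ := R.θ) rfl hy hx
  -- The coin is replaced by its mean θ plus a centered part. The mean contributes θ‖x_{k+1}-u‖²,
  -- which completes the factor 1-θ in Φ_{k+1} to the full square supplied by the extragradient
  -- step.
  have hw : ‖R.w (k + 1) ω - u‖ ^ 2 = R.θ * ‖R.x (k + 1) ω - u‖ ^ 2 +
      (1 - R.θ) * ‖R.w k ω - u‖ ^ 2 + R.c k ω * (‖R.x (k + 1) ω - u‖ ^ 2 - ‖R.w k ω - u‖ ^ 2) := by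
    rw [w_succ, c, coin]
    split_ifs <;> ring
  -- Young's inequality with parameter γ spends the fraction γ of ‖x_{k+1}-y_{k+1}‖². The same
  -- fraction of θ‖y_{k+1}-w_k‖² is moved into q_k, so (1-γ)a_k remains.
  have hyoung : -(2 * R.τ k * inner ℝ (R.d k ω) (R.x (k + 1) ω - R.y k ω)) ≤
      R.τ k ^ 2 / R.γ * ‖R.d k ω‖ ^ 2 + R.γ * ‖R.x (k + 1) ω - R.y k ω‖ ^ 2 := by
    have h1 := (abs_le.1 (abs_real_inner_le_norm (R.d k ω) (R.x (k + 1) ω - R.y k ω))).1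
    set A := ‖R.d k ω‖
    set B := ‖R.x (k + 1) ω - R.y k ω‖
    have h2 : R.τ k ^ 2 / R.γ * A ^ 2 + R.γ * B ^ 2 - 2 * R.τ k * (A * B)
        = (R.τ k * A - R.γ * B) ^ 2 / R.γ := by
      have := R.hγ.ne'
      field_simp
      ring
    have h3 : 0 ≤ (R.τ k * A - R.γ * B) ^ 2 / R.γ := div_nonneg (sq_nonneg _) R.hγ.le
    nlinarith [R.hτ k]
  -- Expanding around x₀ shows that a difference of two squared distances to u is affine in u: the
  -- ‖u-x₀‖² terms cancel. Hence the coin noise splits into a scalar part and a part linear in u -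
  -- x₀.
  have hexp : ∀ v : X, ‖v - u‖ ^ 2 = ‖v - R.x₀‖ ^ 2 - 2 * inner ℝ (v - R.x₀) (u - R.x₀)
      + ‖u - R.x₀‖ ^ 2 := by
    intro v
    rw [← norm_sub_sq_real, sub_sub_sub_cancel_right]
  have hcoin : R.c k ω * (‖R.x (k + 1) ω - u‖ ^ 2 - ‖R.w k ω - u‖ ^ 2) =
      R.c k ω * (‖R.x (k + 1) ω - R.x₀‖ ^ 2 - ‖R.w k ω - R.x₀‖ ^ 2) -
        2 * R.c k ω * inner ℝ (R.x (k + 1) ω - R.w k ω) (u - R.x₀) := by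
    have h1 : inner ℝ (R.x (k + 1) ω - R.w k ω) (u - R.x₀) =
        inner ℝ (R.x (k + 1) ω - R.x₀) (u - R.x₀) - inner ℝ (R.w k ω - R.x₀) (u - R.x₀) := by
      rw [← inner_sub_left, sub_sub_sub_cancel_right]
    rw [hexp (R.x (k + 1) ω), hexp (R.w k ω), h1]
    ring
  have hd : inner ℝ (R.P.V (R.β k) (R.w k ω) + R.d k ω) (R.y k ω - u) =
      inner ℝ (R.P.V (R.β k) (R.y k ω)) (R.y k ω - u) +
        (inner ℝ (R.d k ω - R.m k ω) (R.y k ω - R.x₀)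
          - inner ℝ (R.d k ω - R.m k ω) (u - R.x₀)) := by
    rw [← inner_sub_right, sub_sub_sub_cancel_right, ← inner_add_left]
    congr 1
    simp only [m]
    abel
  rw [hd] at h
  have hr : inner ℝ (R.r k ω) (u - R.x₀) = 2 * R.τ k * inner ℝ (R.d k ω - R.m k ω) (u - R.x₀) -
      2 * R.c k ω * inner ℝ (R.x (k + 1) ω - R.w k ω) (u - R.x₀) := by
    rw [r, inner_sub_left, inner_smul_left, inner_smul_left]
    rfl
  have hα : 0 ≤ (1 - R.θ) * ‖R.y k ω - R.x k ω‖ ^ 2 :=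
    mul_nonneg (sub_nonneg.2 R.hθ') (sq_nonneg _)
  rw [hr]
  simp only [Φ, a, q, n, Γ]
  rw [hw, hcoin]
  nlinarith

end

end Run

/-! ### Square integrability -/

section L2

variable {Ω X : Type*} [MeasurableSpace Ω] {μ : Measure Ω} [NormedAddCommGroup X]

theorem memLp_comp_of_lipschitz [IsFiniteMeasure μ] {Y : Type*} [NormedAddCommGroup Y]
    {f : X → Y} {L : ℝ≥0} (hf : LipschitzWith L f) {Z : Ω → X} (hZ : MemLp Z 2 μ) :
    MemLp (fun ω => f (Z ω)) 2 μ := by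
  have h1 : MemLp (fun ω => f (Z ω) - f 0) 2 μ := by
    refine MemLp.of_le_mul (c := L) hZ
      ((hf.continuous.comp_aestronglyMeasurable hZ.1).sub aestronglyMeasurable_const)
      (Filter.Eventually.of_forall fun ω => ?_)
    simpa [dist_eq_norm] using hf.dist_le_mul (Z ω) 0
  exact (memLp_congr_ae (Filter.Eventually.of_forall fun ω => by simp)).1
    (h1.add (memLp_const (f 0)))

/-- A bound between Lebesgue integrals with values in [0, ∞] yields square integrability and the
real bound at once. -/
theorem memLp_two_of_lintegral_le {f : Ω → X} (hf : AEStronglyMeasurable f μ) {g : Ω → ℝ}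
    (hg : Integrable g μ) (hg0 : ∀ ω, 0 ≤ g ω)
    (h : ∫⁻ ω, ‖f ω‖ₑ ^ 2 ∂μ ≤ ∫⁻ ω, ENNReal.ofReal (g ω) ∂μ) :
    MemLp f 2 μ ∧ ∫ ω, ‖f ω‖ ^ 2 ∂μ ≤ ∫ ω, g ω ∂μ := by
  have he : ∀ ω, ‖f ω‖ₑ ^ 2 = ENNReal.ofReal (‖f ω‖ ^ 2) := fun ω => by
    rw [ENNReal.ofReal_pow (norm_nonneg _), ofReal_norm]
  simp only [he] at h
  have hfin := hg.lintegral_lt_top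
  have hint : Integrable (fun ω => ‖f ω‖ ^ 2) μ := by
    refine (lintegral_ofReal_ne_top_iff_integrable (hf.norm.pow 2)
      (Filter.Eventually.of_forall fun ω => sq_nonneg _)).1 (h.trans_lt hfin).ne
  refine ⟨(memLp_two_iff_integrable_sq_norm hf).2 hint, ?_⟩
  rw [integral_eq_lintegral_of_nonneg_ae (Filter.Eventually.of_forall fun ω => sq_nonneg _) hint.1,
    integral_eq_lintegral_of_nonneg_ae (Filter.Eventually.of_forall hg0) hg.1]
  exact ENNReal.toReal_mono hfin.ne h

end L2

/-! ### Measurability and moments of the iterates -/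

namespace Run

noncomputable section

variable {X A Ξ Ω : Type*} [NormedAddCommGroup X] [InnerProductSpace ℝ X]
  [MeasurableSpace X] [Fintype A] [MeasurableSpace Ξ] [MeasurableSpace Ω]

variable (R : Run X A Ξ Ω)

/-- The information revealed before step `k`. -/
abbrev pst (k : ℕ) : MeasurableSpace Ω := past R.ξ R.b k

/-- The information revealed before the coin toss of step `k`. -/
abbrev hlf (k : ℕ) : MeasurableSpace Ω := half R.ξ R.b k

theorem V_lipschitz (k : ℕ) : ∃ L : ℝ≥0, LipschitzWith L (R.P.V (R.β k)) := by
  obtain ⟨L₁, h₁⟩ := R.hP.F₁_lip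
  obtain ⟨L₂, h₂⟩ := R.hP.F₂_lip
  exact ⟨_, ((lipschitzWith_smul (R.β k)).comp h₁).add h₂⟩

theorem V_continuous (k : ℕ) : Continuous (R.P.V (R.β k)) :=
  (R.V_lipschitz k).choose_spec.continuous

theorem x_succ_eq (k : ℕ) : R.x (k + 1) = (fun a : (X × X) × Ξ =>
    R.P.xStep (1 - R.θ) R.τ R.β R.O k a.1.1 a.1.2 a.2) ∘
      fun ω => ((R.x k ω, R.w k ω), R.ξ k ω) := rfl

theorem d_eq (k : ℕ) : R.d k = (fun a : (X × X) × Ξ =>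
    R.O k a.2 (R.P.yStep (1 - R.θ) R.τ R.β k a.1.1 a.1.2) - R.O k a.2 a.1.2) ∘
      fun ω => ((R.x k ω, R.w k ω), R.ξ k ω) := rfl

theorem pst_le (k : ℕ) : R.pst k ≤ ‹MeasurableSpace Ω› := R.hS.past_le k

theorem hlf_le (k : ℕ) : R.hlf k ≤ ‹MeasurableSpace Ω› := R.hS.half_le k

theorem memLp_V (k : ℕ) {Z : Ω → X} (hZ : MemLp Z 2 R.μ) :
    MemLp (fun ω => R.P.V (R.β k) (Z ω)) 2 R.μ :=
  memLp_comp_of_lipschitz (R.V_lipschitz k).choose_spec hZ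

theorem c_measurable (k : ℕ) : Measurable (R.c k) := R.hS.measurable_coin k

theorem abs_c_le (k : ℕ) (ω : Ω) : |R.c k ω| ≤ 1 := by
  have h1 := R.hθ
  have h2 := R.hθ'
  simp only [c, coin]
  split_ifs <;> rw [abs_le] <;> constructor <;> linarith

theorem integral_c_mul (k : ℕ) {W : Ω → ℝ} (hW : Measurable[R.hlf k] W) :
    ∫ ω, R.c k ω * W ω ∂(R.μ) = 0 := R.hS.integral_coin_mul R.hθ.le hW

theorem integral_c_sq_mul (k : ℕ) {W : Ω → ℝ} (hW : Measurable[R.hlf k] W) :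
    ∫ ω, R.c k ω ^ 2 * W ω ∂(R.μ) = R.θ * (1 - R.θ) * ∫ ω, W ω ∂(R.μ) :=
  R.hS.integral_coin_sq_mul R.hθ.le hW

theorem integrable_c_mul (k : ℕ) {W : Ω → ℝ} (hW : Integrable W R.μ) :
    Integrable (fun ω => R.c k ω * W ω) R.μ :=
  hW.bdd_mul (c := 1) (R.c_measurable k).aestronglyMeasurable
    (Filter.Eventually.of_forall fun ω => R.abs_c_le k ω)

variable [FiniteDimensional ℝ X]

theorem memLp_pr (k : ℕ) {Z : Ω → X} (hZ : MemLp Z 2 R.μ) :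
    MemLp (fun ω => R.pr k (Z ω)) 2 R.μ :=
  memLp_comp_of_lipschitz (L := 1) (LipschitzWith.of_dist_le_mul fun z z' => by
    simpa [dist_eq_norm] using R.pr_lipschitz k z z') hZ

theorem memLp_y_of {k : ℕ} (hx : MemLp (R.x k) 2 R.μ) (hw : MemLp (R.w k) 2 R.μ) :
    MemLp (R.y k) 2 R.μ := by
  have h : R.y k = fun ω => R.pr k ((1 - R.θ) • R.x k ω + R.θ • R.w k ω -
      R.τ k • R.P.V (R.β k) (R.w k ω)) := funext fun ω => R.y_eq k ω
  rw [h]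
  exact R.memLp_pr k (((hx.const_smul _).add (hw.const_smul _)).sub ((R.memLp_V k hw).const_smul _))

variable [BorelSpace X]

theorem measurable_yStep (k : ℕ) :
    Measurable fun a : X × X => R.P.yStep (1 - R.θ) R.τ R.β k a.1 a.2 :=
  (R.pr_continuous k).measurable.comp (((measurable_fst.const_smul _).add
    (measurable_snd.const_smul _)).sub
      (((R.V_continuous k).measurable.comp measurable_snd).const_smul _))

theorem measurable_oracle_sub (k : ℕ) : Measurable fun a : (X × X) × Ξ =>
    R.O k a.2 (R.P.yStep (1 - R.θ) R.τ R.β k a.1.1 a.1.2) - R.O k a.2 a.1.2 :=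
  ((R.hO.meas k).comp (measurable_snd.prodMk ((R.measurable_yStep k).comp measurable_fst))).sub
    ((R.hO.meas k).comp (measurable_snd.prodMk measurable_fst.snd))

theorem measurable_xStep (k : ℕ) : Measurable fun a : (X × X) × Ξ =>
    R.P.xStep (1 - R.θ) R.τ R.β R.O k a.1.1 a.1.2 a.2 := by
  have hV := (R.V_continuous k).measurable.comp (measurable_fst.snd : Measurable
    fun a : (X × X) × Ξ => a.1.2)
  have h : Measurable fun a : (X × X) × Ξ => R.pr k ((1 - R.θ) • a.1.1 + (1 - (1 - R.θ)) • a.1.2 -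
      R.τ k • (R.P.V (R.β k) a.1.2 +
        (R.O k a.2 (R.P.yStep (1 - R.θ) R.τ R.β k a.1.1 a.1.2) - R.O k a.2 a.1.2))) :=
    (R.pr_continuous k).measurable.comp (((measurable_fst.fst.const_smul (1 - R.θ)).add
      (measurable_fst.snd.const_smul (1 - (1 - R.θ)))).sub
        ((hV.add (R.measurable_oracle_sub k)).const_smul (R.τ k)))
  simpa only [Problem.xStep, add_sub_assoc, pr] using h

theorem xw_measurable (k : ℕ) : Measurable[R.pst k] (R.x k) ∧ Measurable[R.pst k] (R.w k) := by
  induction k with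
  | zero => exact ⟨measurable_const, measurable_const⟩
  | succ k ih =>
    have hx := ih.1.mono (past_mono k.le_succ) le_rfl
    have hw := ih.2.mono (past_mono k.le_succ) le_rfl
    have hn := measurable_noise (ξ := R.ξ) (b := R.b) k
    have hx' : Measurable[R.pst (k + 1)] (R.x (k + 1)) := by
      rw [R.x_succ_eq]
      exact (R.measurable_xStep k).comp ((hx.prodMk hw).prodMk hn.fst)
    refine ⟨hx', ?_⟩
    have hb : MeasurableSet[R.pst (k + 1)] {ω | R.b k ω = true} :=
      hn.snd (measurableSet_singleton true)
    exact Measurable.ite hb hx' hw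

theorem x_measurable (k : ℕ) : Measurable[R.pst k] (R.x k) := (R.xw_measurable k).1

theorem w_measurable (k : ℕ) : Measurable[R.pst k] (R.w k) := (R.xw_measurable k).2

theorem y_measurable (k : ℕ) : Measurable[R.pst k] (R.y k) :=
  (R.measurable_yStep k).comp ((R.x_measurable k).prodMk (R.w_measurable k))

theorem m_measurable (k : ℕ) : Measurable[R.pst k] (R.m k) :=
  ((R.V_continuous k).measurable.comp (R.y_measurable k)).sub
    ((R.V_continuous k).measurable.comp (R.w_measurable k))

theorem w_measurable_half (k : ℕ) : Measurable[R.hlf k] (R.w k) :=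
  (R.w_measurable k).mono (past_le_half k) le_rfl

theorem m_measurable_half (k : ℕ) : Measurable[R.hlf k] (R.m k) :=
  (R.m_measurable k).mono (past_le_half k) le_rfl

theorem d_measurable_half (k : ℕ) : Measurable[R.hlf k] (R.d k) :=
  R.d_eq k ▸ (R.measurable_oracle_sub k).comp
    ((((R.x_measurable k).mono (past_le_half k) le_rfl).prodMk
      ((R.w_measurable k).mono (past_le_half k) le_rfl)).prodMk (measurable_sample_half k))

/-- The sample of step k enters x_{k+1} but the coin of step k does not; this is what centers the
coin noise. -/
theorem x_succ_measurable_half (k : ℕ) : Measurable[R.hlf k] (R.x (k + 1)) :=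
  R.x_succ_eq k ▸ (R.measurable_xStep k).comp
    ((((R.x_measurable k).mono (past_le_half k) le_rfl).prodMk
      ((R.w_measurable k).mono (past_le_half k) le_rfl)).prodMk (measurable_sample_half k))

theorem y_measurable' (k : ℕ) : Measurable (R.y k) := (R.y_measurable k).mono (R.pst_le k) le_rfl

/-- Both arguments of the oracle are determined by the past, so they may be frozen while the
mean-square Lipschitz bound is applied to the fresh sample. -/
theorem memLp_d_of {k : ℕ} (hy : MemLp (R.y k) 2 R.μ) (hw : MemLp (R.w k) 2 R.μ) :
    MemLp (R.d k) 2 R.μ ∧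
      ∫ ω, ‖R.d k ω‖ ^ 2 ∂(R.μ) ≤ ∫ ω, R.ℒ k ^ 2 * ‖R.y k ω - R.w k ω‖ ^ 2 ∂(R.μ) := by
  have hd := (R.d_measurable_half k).mono (R.hlf_le k) le_rfl
  refine memLp_two_of_lintegral_le hd.aestronglyMeasurable
    (((hy.sub hw).integrable_norm_pow two_ne_zero).const_mul _) (fun ω => by positivity) ?_
  have hm1 : Measurable fun a : (X × X) × Ξ => R.O k a.2 a.1.1 :=
    (R.hO.meas k).comp (measurable_snd.prodMk measurable_fst.fst)
  have hm2 : Measurable fun a : (X × X) × Ξ => R.O k a.2 a.1.2 :=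
    (R.hO.meas k).comp (measurable_snd.prodMk measurable_fst.snd)
  have h := R.hS.lintegral_sample ((R.y_measurable k).prodMk (R.w_measurable k))
    (f := fun z s => ‖R.O k s z.1 - R.O k s z.2‖ₑ ^ 2) ((hm1.sub hm2).enorm.pow_const 2)
  simp only [d]
  rw [h]
  exact lintegral_mono fun ω => R.hO.lip k _ _

/-- The proximal map and V_k are Lipschitz and hence preserve L², and the sampled difference is in
L² by `memLp_d_of`; the snapshot is one of two L² points. -/
theorem memLp_xw (k : ℕ) : MemLp (R.x k) 2 R.μ ∧ MemLp (R.w k) 2 R.μ := by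
  induction k with
  | zero => exact ⟨memLp_const R.x₀, memLp_const R.x₀⟩
  | succ k ih =>
    obtain ⟨hx, hw⟩ := ih
    have hx' : MemLp (R.x (k + 1)) 2 R.μ := by
      have h : R.x (k + 1) = fun ω => R.pr k ((1 - R.θ) • R.x k ω + R.θ • R.w k ω -
          R.τ k • (R.P.V (R.β k) (R.w k ω) + R.d k ω)) := funext fun ω => R.x_succ k ω
      rw [h]
      exact R.memLp_pr k (((hx.const_smul _).add (hw.const_smul _)).sub
        (((R.memLp_V k hw).add (R.memLp_d_of (R.memLp_y_of hx hw) hw).1).const_smul _))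
    refine ⟨hx', ?_⟩
    refine MemLp.mono' (g := fun ω => ‖R.x (k + 1) ω‖ + ‖R.w k ω‖) (hx'.norm.add hw.norm)
      ((R.w_measurable (k + 1)).mono (R.pst_le _) le_rfl).aestronglyMeasurable
      (Filter.Eventually.of_forall fun ω => ?_)
    rw [w_succ]
    split_ifs
    · exact le_add_of_nonneg_right (norm_nonneg _)
    · exact le_add_of_nonneg_left (norm_nonneg _)

theorem memLp_x (k : ℕ) : MemLp (R.x k) 2 R.μ := (R.memLp_xw k).1

theorem memLp_w (k : ℕ) : MemLp (R.w k) 2 R.μ := (R.memLp_xw k).2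

theorem memLp_y (k : ℕ) : MemLp (R.y k) 2 R.μ := R.memLp_y_of (R.memLp_x k) (R.memLp_w k)

theorem memLp_d (k : ℕ) : MemLp (R.d k) 2 R.μ := (R.memLp_d_of (R.memLp_y k) (R.memLp_w k)).1

theorem memLp_m (k : ℕ) : MemLp (R.m k) 2 R.μ :=
  (R.memLp_V k (R.memLp_y k)).sub (R.memLp_V k (R.memLp_w k))

/-- Mean square bound for the sampled differences. -/
theorem sq_integral_d_le (k : ℕ) : R.τ k ^ 2 * ∫ ω, ‖R.d k ω‖ ^ 2 ∂(R.μ) ≤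
    R.θ * R.γ ^ 2 * ∫ ω, ‖R.y k ω - R.w k ω‖ ^ 2 ∂(R.μ) := by
  have h1 := (R.memLp_d_of (R.memLp_y k) (R.memLp_w k)).2
  rw [integral_const_mul] at h1
  have hL := R.hO.pos k
  have h2 : R.τ k * R.ℒ k ≤ √R.θ * R.γ := by
    have h := mul_le_mul_of_nonneg_right (R.hτ' k) hL.le
    rwa [div_mul_eq_mul_div, div_mul_cancel₀ _ hL.ne'] at h
  have h3 : (R.τ k * R.ℒ k) ^ 2 ≤ R.θ * R.γ ^ 2 := by
    have h := pow_le_pow_left₀ (mul_nonneg (R.hτ k).le hL.le) h2 2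
    rwa [mul_pow (√R.θ), Real.sq_sqrt R.hθ.le] at h
  have h4 : 0 ≤ ∫ ω, ‖R.y k ω - R.w k ω‖ ^ 2 ∂(R.μ) := integral_nonneg fun ω => sq_nonneg _
  calc R.τ k ^ 2 * ∫ ω, ‖R.d k ω‖ ^ 2 ∂(R.μ)
      ≤ R.τ k ^ 2 * (R.ℒ k ^ 2 * ∫ ω, ‖R.y k ω - R.w k ω‖ ^ 2 ∂(R.μ)) :=
        mul_le_mul_of_nonneg_left h1 (sq_nonneg _)
    _ = (R.τ k * R.ℒ k) ^ 2 * ∫ ω, ‖R.y k ω - R.w k ω‖ ^ 2 ∂(R.μ) := by ring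
    _ ≤ _ := mul_le_mul_of_nonneg_right h3 h4

theorem integrable_yw (k : ℕ) : Integrable (fun ω => ‖R.y k ω - R.w k ω‖ ^ 2) R.μ :=
  ((R.memLp_y k).sub (R.memLp_w k)).integrable_norm_pow two_ne_zero

theorem integrable_xy (k : ℕ) : Integrable (fun ω => ‖R.x (k + 1) ω - R.y k ω‖ ^ 2) R.μ :=
  ((R.memLp_x (k + 1)).sub (R.memLp_y k)).integrable_norm_pow two_ne_zero

theorem integrable_a (k : ℕ) : Integrable (R.a k) R.μ :=
  ((R.integrable_yw k).const_mul _).add (R.integrable_xy k)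

theorem integrable_q (k : ℕ) : Integrable (R.q k) R.μ :=
  (((R.memLp_d k).integrable_norm_pow two_ne_zero).const_mul _).sub
    ((R.integrable_yw k).const_mul _)

theorem integrable_Φ (k : ℕ) (u : X) : Integrable (fun ω => R.Φ k ω u) R.μ :=
  ((((R.memLp_x k).sub (memLp_const u)).integrable_norm_pow two_ne_zero).const_mul _).add
    (((R.memLp_w k).sub (memLp_const u)).integrable_norm_pow two_ne_zero)

/-- This is where the step-size rule acts: (τ_k ℒ_k)² ≤ θγ² is just enough for the part of
θ‖y_{k+1}-w_k‖² set aside to absorb the sampling error. -/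
theorem integral_q_le (k : ℕ) : ∫ ω, R.q k ω ∂(R.μ) ≤ 0 := by
  have h := R.sq_integral_d_le k
  simp only [q]
  rw [integral_sub (((R.memLp_d k).integrable_norm_pow two_ne_zero).const_mul _)
    ((R.integrable_yw k).const_mul _), integral_const_mul, integral_const_mul,
    div_mul_eq_mul_div, sub_nonpos, div_le_iff₀ R.hγ]
  linarith

/-- With the past frozen, unbiasedness at the two points y_{k+1} and w_k makes the mean of the
sampled difference equal to the exact one. -/
theorem integral_inner_sample (k : ℕ) {Z : Ω → X} (hZ : Measurable[R.pst k] Z)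
    (hZ2 : MemLp Z 2 R.μ) : ∫ ω, inner ℝ (R.d k ω - R.m k ω) (Z ω) ∂(R.μ) = 0 := by
  have hm1 : Measurable fun a : (X × X × X) × Ξ => R.O k a.2 a.1.2.1 :=
    (R.hO.meas k).comp (measurable_snd.prodMk measurable_fst.snd.fst)
  have hm2 : Measurable fun a : (X × X × X) × Ξ => R.O k a.2 a.1.2.2 :=
    (R.hO.meas k).comp (measurable_snd.prodMk measurable_fst.snd.snd)
  have hV := (R.V_continuous k).measurable
  refine R.hS.integral_sample_eq_zero
    (hZ.prodMk ((R.y_measurable k).prodMk (R.w_measurable k)))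
    (f := fun z s => inner ℝ (R.O k s z.2.1 - R.O k s z.2.2 -
      (R.P.V (R.β k) z.2.1 - R.P.V (R.β k) z.2.2)) z.1)
    (((hm1.sub hm2).sub ((hV.comp measurable_fst.snd.fst).sub
      (hV.comp measurable_fst.snd.snd))).inner measurable_fst.fst) (fun z => ?_)
    (memLp_inner ((R.memLp_d k).sub (R.memLp_m k)) hZ2)
  have hi1 := R.hO.integrable k z.2.1
  have hi2 := R.hO.integrable k z.2.2
  have h0 : ∫ s, (R.O k s z.2.1 - R.O k s z.2.2 -
      (R.P.V (R.β k) z.2.1 - R.P.V (R.β k) z.2.2)) ∂(R.Q) = 0 := by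
    have hi : Integrable (fun s => R.O k s z.2.1 - R.O k s z.2.2) R.Q := hi1.sub hi2
    rw [integral_sub hi (integrable_const _), integral_sub hi1 hi2,
      R.hO.unbiased, R.hO.unbiased]
    simp
  have h1 := integral_inner (𝕜 := ℝ) ((hi1.sub hi2).sub (integrable_const
    (R.P.V (R.β k) z.2.1 - R.P.V (R.β k) z.2.2))) z.1
  simp only [Pi.sub_apply] at h1
  simp only [fun s => real_inner_comm z.1 (R.O k s z.2.1 - R.O k s z.2.2 -
      (R.P.V (R.β k) z.2.1 - R.P.V (R.β k) z.2.2))]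
  rw [h1, h0, inner_zero_right]

theorem integrable_n_and (k : ℕ) : Integrable (R.n k) R.μ ∧ ∫ ω, R.n k ω ∂(R.μ) = 0 := by
  have hy2 : MemLp (fun ω => R.y k ω - R.x₀) 2 R.μ := (R.memLp_y k).sub (memLp_const _)
  have hi1 : Integrable (fun ω => -(2 * R.τ k * inner ℝ (R.d k ω - R.m k ω) (R.y k ω - R.x₀))) R.μ :=
    ((memLp_inner ((R.memLp_d k).sub (R.memLp_m k)) hy2).const_mul _).neg
  have hi2 : Integrable (fun ω => R.c k ω *
      (‖R.x (k + 1) ω - R.x₀‖ ^ 2 - ‖R.w k ω - R.x₀‖ ^ 2)) R.μ :=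
    R.integrable_c_mul k
      ((((R.memLp_x (k + 1)).sub (memLp_const R.x₀)).integrable_norm_pow two_ne_zero).sub
        (((R.memLp_w k).sub (memLp_const R.x₀)).integrable_norm_pow two_ne_zero))
  have hg : Measurable fun a : X × X => ‖a.1 - R.x₀‖ ^ 2 - ‖a.2 - R.x₀‖ ^ 2 :=
    Continuous.measurable (by fun_prop)
  have hW : Measurable[R.hlf k] fun ω => ‖R.x (k + 1) ω - R.x₀‖ ^ 2 - ‖R.w k ω - R.x₀‖ ^ 2 :=
    hg.comp ((R.x_succ_measurable_half k).prodMk (R.w_measurable_half k))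
  refine ⟨hi1.add hi2, ?_⟩
  simp only [n]
  rw [integral_add hi1 hi2, integral_neg, integral_const_mul,
    R.integral_inner_sample k (Z := fun ω => R.y k ω - R.x₀)
      ((R.y_measurable k).sub measurable_const) hy2,
    R.integral_c_mul k hW]
  simp

end

/-! ### Martingale noise and the energy estimate -/

noncomputable section

variable {X A Ξ Ω : Type*} [NormedAddCommGroup X] [InnerProductSpace ℝ X]
  [MeasurableSpace X] [Fintype A] [MeasurableSpace Ξ] [MeasurableSpace Ω]

variable (R : Run X A Ξ Ω)

/-- The weighted sum of the vectorial noise terms. -/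
def noiseSum (v : ℕ → ℝ) (K : ℕ) (ω : Ω) : X := ∑ k ∈ Finset.range K, v k • R.r k ω

theorem memLp_c_smul (k : ℕ) {Z : Ω → X} (hZ : MemLp Z 2 R.μ) :
    MemLp (fun ω => (2 * R.c k ω) • Z ω) 2 R.μ := by
  refine MemLp.of_le_mul (c := 2) hZ
    (((R.c_measurable k).const_mul 2).aestronglyMeasurable.smul hZ.1)
    (Filter.Eventually.of_forall fun ω => ?_)
  rw [norm_smul, Real.norm_eq_abs, abs_mul, abs_two]
  have := R.abs_c_le k ω
  exact mul_le_mul_of_nonneg_right (by linarith) (norm_nonneg _)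

theorem inner_r (k : ℕ) (ω : Ω) (z : X) : inner ℝ (R.r k ω) z =
    2 * R.τ k * inner ℝ (R.d k ω - R.m k ω) z -
      2 * (R.c k ω * inner ℝ (R.x (k + 1) ω - R.w k ω) z) := by
  rw [r, inner_sub_left, inner_smul_left, inner_smul_left]
  simp only [conj_trivial]
  ring

theorem noiseSum_succ (v : ℕ → ℝ) (K : ℕ) (ω : Ω) :
    R.noiseSum v (K + 1) ω = R.noiseSum v K ω + v K • R.r K ω := by
  rw [noiseSum, Finset.sum_range_succ]
  rfl

theorem integral_a_nonneg (k : ℕ) : 0 ≤ ∫ ω, R.a k ω ∂(R.μ) :=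
  integral_nonneg fun ω => by
    have := R.hθ
    simp only [a]
    positivity

theorem Φ_zero_le (ω : Ω) (u : X) : R.Φ 0 ω u ≤ 2 * ‖u - R.x₀‖ ^ 2 := by
  have h := mul_nonneg R.hθ.le (sq_nonneg ‖u - R.x₀‖)
  simp only [Φ, x_zero, w_zero, norm_sub_rev R.x₀ u]
  linarith

theorem Φ_nonneg (k : ℕ) (ω : Ω) (u : X) : 0 ≤ R.Φ k ω u :=
  add_nonneg (mul_nonneg (sub_nonneg.2 R.hθ') (sq_nonneg _)) (sq_nonneg _)

/-- The series `∑ τ_k h_k` as a real number. -/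
def H : ℝ := (R.P.hSum R.τ R.β R.p).toReal

/-- Bound for the expected Lyapunov function. -/
def E₀ : ℝ := 2 * ‖R.xs - R.x₀‖ ^ 2 + 2 * R.H

theorem h_ne_top (hH : R.P.hSum R.τ R.β R.p ≠ ⊤) (k : ℕ) :
    (R.P.h (R.β k) R.p).toENNReal ≠ ⊤ := by
  intro h
  refine ENNReal.ne_top_of_tsum_ne_top hH k ?_
  rw [h, ENNReal.mul_top]
  simpa using R.hτ k

theorem sum_hk_le (hH : R.P.hSum R.τ R.β R.p ≠ ⊤) (K : ℕ) :
    ∑ k ∈ Finset.range K, R.τ k * R.hk k ≤ R.H := by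
  have h1 := ENNReal.toReal_mono hH (ENNReal.sum_le_tsum (Finset.range K) (f := fun k =>
    ENNReal.ofReal (R.τ k) * (R.P.h (R.β k) R.p).toENNReal))
  rw [ENNReal.toReal_sum fun k _ => ENNReal.mul_ne_top ENNReal.ofReal_ne_top (R.h_ne_top hH k)] at h1
  refine le_trans (Finset.sum_le_sum fun k _ => ?_) h1
  rw [ENNReal.toReal_mul, ENNReal.toReal_ofReal (R.hτ k).le, hk]

variable [FiniteDimensional ℝ X] [BorelSpace X]

theorem memLp_dm (k : ℕ) : MemLp (fun ω => R.d k ω - R.m k ω) 2 R.μ :=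
  (R.memLp_d k).sub (R.memLp_m k)

theorem memLp_xw_sub (k : ℕ) : MemLp (fun ω => R.x (k + 1) ω - R.w k ω) 2 R.μ :=
  (R.memLp_x (k + 1)).sub (R.memLp_w k)

theorem xw_sub_measurable_half (k : ℕ) :
    Measurable[R.hlf k] fun ω => R.x (k + 1) ω - R.w k ω :=
  (R.x_succ_measurable_half k).sub (R.w_measurable_half k)

theorem dm_measurable_half (k : ℕ) : Measurable[R.hlf k] fun ω => R.d k ω - R.m k ω :=
  (R.d_measurable_half k).sub (R.m_measurable_half k)

/-- Centering the sampled differences does not increase the second moment. -/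
theorem sq_integral_dm_le (k : ℕ) : R.τ k ^ 2 * ∫ ω, ‖R.d k ω - R.m k ω‖ ^ 2 ∂(R.μ) ≤
    R.θ * R.γ ^ 2 * ∫ ω, ‖R.y k ω - R.w k ω‖ ^ 2 ∂(R.μ) := by
  refine le_trans (mul_le_mul_of_nonneg_left ?_ (sq_nonneg _)) (R.sq_integral_d_le k)
  have he : ∀ ω, ‖R.d k ω‖ ^ 2 = ‖R.d k ω - R.m k ω‖ ^ 2 +
      2 * inner ℝ (R.d k ω - R.m k ω) (R.m k ω) + ‖R.m k ω‖ ^ 2 := fun ω => by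
    rw [← norm_add_sq_real, sub_add_cancel]
  have h1 := (R.memLp_dm k).integrable_norm_pow two_ne_zero
  have h2 := (memLp_inner (R.memLp_dm k) (R.memLp_m k)).const_mul 2
  have h3 := (R.memLp_m k).integrable_norm_pow two_ne_zero
  have h12 : Integrable (fun ω => ‖R.d k ω - R.m k ω‖ ^ 2 +
      2 * inner ℝ (R.d k ω - R.m k ω) (R.m k ω)) R.μ := h1.add h2
  simp only [he]
  rw [integral_add h12 h3, integral_add h1 h2, integral_const_mul,
    R.integral_inner_sample k (R.m_measurable k) (R.memLp_m k)]
  have h4 : 0 ≤ ∫ ω, ‖R.m k ω‖ ^ 2 ∂(R.μ) := integral_nonneg fun ω => sq_nonneg _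
  linarith

theorem memLp_r (k : ℕ) : MemLp (R.r k) 2 R.μ :=
  ((R.memLp_dm k).const_smul (2 * R.τ k)).sub (R.memLp_c_smul k (R.memLp_xw_sub k))

/-- The martingale-difference property of r_k: the oracle part is centered given the past, the coin
part given past and sample. -/
theorem integral_inner_r (k : ℕ) {Z : Ω → X} (hZ : Measurable[R.pst k] Z)
    (hZ2 : MemLp Z 2 R.μ) : ∫ ω, inner ℝ (R.r k ω) (Z ω) ∂(R.μ) = 0 := by
  have h1 := (memLp_inner (R.memLp_dm k) hZ2).const_mul (2 * R.τ k)
  have h2 := (R.integrable_c_mul k (memLp_inner (R.memLp_xw_sub k) hZ2)).const_mul 2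
  have hg : Measurable fun a : X × X => inner ℝ a.1 a.2 := Continuous.measurable (by fun_prop)
  have hW : Measurable[R.hlf k] fun ω => inner ℝ (R.x (k + 1) ω - R.w k ω) (Z ω) :=
    hg.comp ((R.xw_sub_measurable_half k).prodMk (hZ.mono (past_le_half k) le_rfl))
  simp only [inner_r]
  rw [integral_sub h1 h2, integral_const_mul, integral_const_mul,
    R.integral_inner_sample k hZ hZ2, R.integral_c_mul k hW]
  simp

/-- The cross term is linear in the centered coin and vanishes. The oracle part costs 4θ‖y-w‖² in
mean; the coin has variance θ(1-θ), so its part costs at most 8θ‖y-w‖² + 8‖x_{k+1}-y‖². The factor θ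
in the variance is essential, since a_k carries only θ‖y-w‖². -/
theorem integral_norm_r_sq_le (k : ℕ) :
    ∫ ω, ‖R.r k ω‖ ^ 2 ∂(R.μ) ≤ 12 * ∫ ω, R.a k ω ∂(R.μ) := by
  have he : ∀ ω, ‖R.r k ω‖ ^ 2 = 4 * R.τ k ^ 2 * ‖R.d k ω - R.m k ω‖ ^ 2 -
      8 * R.τ k * (R.c k ω * inner ℝ (R.d k ω - R.m k ω) (R.x (k + 1) ω - R.w k ω)) +
      4 * (R.c k ω ^ 2 * ‖R.x (k + 1) ω - R.w k ω‖ ^ 2) := by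
    intro ω
    rw [r, norm_sub_sq_real, norm_smul, norm_smul, mul_pow, mul_pow, Real.norm_eq_abs,
      Real.norm_eq_abs, sq_abs, sq_abs, inner_smul_left, inner_smul_right]
    simp only [conj_trivial]
    ring
  have h1 := ((R.memLp_dm k).integrable_norm_pow two_ne_zero).const_mul (4 * R.τ k ^ 2)
  have hi := memLp_inner (R.memLp_dm k) (R.memLp_xw_sub k)
  have h2 := (R.integrable_c_mul k hi).const_mul (8 * R.τ k)
  have hxw := (R.memLp_xw_sub k).integrable_norm_pow two_ne_zero
  have h3 : Integrable (fun ω => 4 * (R.c k ω ^ 2 * ‖R.x (k + 1) ω - R.w k ω‖ ^ 2)) R.μ := by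
    refine Integrable.const_mul ?_ 4
    simp only [pow_two (R.c k _), mul_assoc]
    exact R.integrable_c_mul k (R.integrable_c_mul k hxw)
  have hg : Measurable fun a : X × X => inner ℝ a.1 a.2 := Continuous.measurable (by fun_prop)
  have hW : Measurable[R.hlf k] fun ω =>
      inner ℝ (R.d k ω - R.m k ω) (R.x (k + 1) ω - R.w k ω) :=
    hg.comp ((R.dm_measurable_half k).prodMk (R.xw_sub_measurable_half k))
  have hg' : Measurable fun a : X => ‖a‖ ^ 2 := Continuous.measurable (by fun_prop)
  have hW' : Measurable[R.hlf k] fun ω => ‖R.x (k + 1) ω - R.w k ω‖ ^ 2 :=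
    hg'.comp (R.xw_sub_measurable_half k)
  have h12 : Integrable (fun ω => 4 * R.τ k ^ 2 * ‖R.d k ω - R.m k ω‖ ^ 2 -
      8 * R.τ k * (R.c k ω * inner ℝ (R.d k ω - R.m k ω) (R.x (k + 1) ω - R.w k ω))) R.μ :=
    h1.sub h2
  have hxw_le : ∫ ω, ‖R.x (k + 1) ω - R.w k ω‖ ^ 2 ∂(R.μ) ≤
      2 * ∫ ω, ‖R.x (k + 1) ω - R.y k ω‖ ^ 2 ∂(R.μ) +
        2 * ∫ ω, ‖R.y k ω - R.w k ω‖ ^ 2 ∂(R.μ) := by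
    rw [← integral_const_mul, ← integral_const_mul,
      ← integral_add ((R.integrable_xy k).const_mul 2) ((R.integrable_yw k).const_mul 2)]
    refine integral_mono hxw (((R.integrable_xy k).const_mul 2).add
      ((R.integrable_yw k).const_mul 2)) fun ω => ?_
    have h4 := norm_add_le (R.x (k + 1) ω - R.y k ω) (R.y k ω - R.w k ω)
    rw [sub_add_sub_cancel] at h4
    simp only
    nlinarith [sq_nonneg (‖R.x (k + 1) ω - R.y k ω‖ - ‖R.y k ω - R.w k ω‖),
      norm_nonneg (R.x (k + 1) ω - R.w k ω)]
  have ha : ∫ ω, R.a k ω ∂(R.μ) = R.θ * ∫ ω, ‖R.y k ω - R.w k ω‖ ^ 2 ∂(R.μ) +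
      ∫ ω, ‖R.x (k + 1) ω - R.y k ω‖ ^ 2 ∂(R.μ) := by
    simp only [a]
    rw [integral_add ((R.integrable_yw k).const_mul _) (R.integrable_xy k), integral_const_mul]
  simp only [he]
  rw [integral_add h12 h3, integral_sub h1 h2, integral_const_mul, integral_const_mul,
    integral_const_mul, R.integral_c_mul k hW, R.integral_c_sq_mul k hW', ha]
  have h5 := R.sq_integral_dm_le k
  have hyw : 0 ≤ ∫ ω, ‖R.y k ω - R.w k ω‖ ^ 2 ∂(R.μ) := integral_nonneg fun ω => sq_nonneg _
  have hxy : 0 ≤ ∫ ω, ‖R.x (k + 1) ω - R.y k ω‖ ^ 2 ∂(R.μ) := integral_nonneg fun ω => sq_nonneg _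
  have hθ := R.hθ
  have hθ' := R.hθ'
  have h6 := mul_le_mul_of_nonneg_left hxw_le (mul_nonneg hθ.le (sub_nonneg.2 hθ'))
  set p := ∫ ω, ‖R.y k ω - R.w k ω‖ ^ 2 ∂(R.μ)
  set s := ∫ ω, ‖R.x (k + 1) ω - R.y k ω‖ ^ 2 ∂(R.μ)
  have h7 : R.θ * R.γ ^ 2 * p ≤ R.θ * p := by
    have : R.γ ^ 2 ≤ 1 := by nlinarith [R.hγ, R.hγ']
    nlinarith [mul_nonneg hθ.le hyw]
  have h8 : R.θ * (1 - R.θ) * (2 * p) ≤ R.θ * (2 * p) := by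
    nlinarith [mul_nonneg (mul_nonneg hθ.le hyw) hθ.le]
  have h9 : R.θ * (1 - R.θ) * (2 * s) ≤ 2 * s := by
    nlinarith [mul_nonneg hxy (mul_nonneg hθ.le hθ.le), mul_nonneg hxy (sub_nonneg.2 hθ')]
  nlinarith

theorem r_measurable (k : ℕ) : Measurable[R.pst (k + 1)] (R.r k) := by
  have hn := measurable_noise (ξ := R.ξ) (b := R.b) k
  have hx := (R.x_measurable k).mono (past_mono k.le_succ) le_rfl
  have hw := (R.w_measurable k).mono (past_mono k.le_succ) le_rfl
  have hm := (R.m_measurable k).mono (past_mono k.le_succ) le_rfl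
  have hx' := R.x_measurable (k + 1)
  have hd : Measurable[R.pst (k + 1)] (R.d k) := by
    rw [R.d_eq]
    exact (R.measurable_oracle_sub k).comp ((hx.prodMk hw).prodMk hn.fst)
  have hc : Measurable[R.pst (k + 1)] (R.c k) :=
    (measurable_of_countable fun c : Bool => ((if c then 1 else 0) - R.θ : ℝ)).comp hn.snd
  have hg : Measurable fun a : ((X × X) × ℝ) × (X × X) =>
      (2 * R.τ k) • (a.1.1.1 - a.1.1.2) - (2 * a.1.2) • (a.2.1 - a.2.2) :=
    Continuous.measurable (by fun_prop)
  exact hg.comp (((hd.prodMk hm).prodMk hc).prodMk (hx'.prodMk hw))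

theorem noiseSum_measurable (v : ℕ → ℝ) (K : ℕ) : Measurable[R.pst K] (R.noiseSum v K) := by
  induction K with
  | zero =>
    have : R.noiseSum v 0 = fun _ => 0 := by funext ω; simp [noiseSum]
    rw [this]
    exact measurable_const
  | succ k ih =>
    have h : R.noiseSum v (k + 1) = fun ω => R.noiseSum v k ω + v k • R.r k ω :=
      funext fun ω => R.noiseSum_succ v k ω
    have hg : Measurable fun a : X × X => a.1 + v k • a.2 := Continuous.measurable (by fun_prop)
    rw [h]
    exact hg.comp ((ih.mono (past_mono k.le_succ) le_rfl).prodMk (R.r_measurable k))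

theorem memLp_noiseSum (v : ℕ → ℝ) (K : ℕ) : MemLp (R.noiseSum v K) 2 R.μ :=
  memLp_finsetSum _ fun k _ => (R.memLp_r k).const_smul (v k)

/-- Partial sums are measurable with respect to the past, so each new increment is orthogonal to
them and the second moments add up. -/
theorem integral_norm_noiseSum_sq_le (v : ℕ → ℝ) (K : ℕ) :
    ∫ ω, ‖R.noiseSum v K ω‖ ^ 2 ∂(R.μ) ≤
      12 * ∑ k ∈ Finset.range K, v k ^ 2 * ∫ ω, R.a k ω ∂(R.μ) := by
  induction K with
  | zero => simp [noiseSum]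
  | succ k ih =>
    have he : ∀ ω, ‖R.noiseSum v (k + 1) ω‖ ^ 2 = ‖R.noiseSum v k ω‖ ^ 2 +
        2 * v k * inner ℝ (R.r k ω) (R.noiseSum v k ω) + v k ^ 2 * ‖R.r k ω‖ ^ 2 := by
      intro ω
      rw [noiseSum_succ, norm_add_sq_real, norm_smul, mul_pow, Real.norm_eq_abs, sq_abs,
        inner_smul_right, real_inner_comm]
      ring
    have h1 := (R.memLp_noiseSum v k).integrable_norm_pow two_ne_zero
    have h2 := (memLp_inner (R.memLp_r k) (R.memLp_noiseSum v k)).const_mul (2 * v k)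
    have h3 := ((R.memLp_r k).integrable_norm_pow two_ne_zero).const_mul (v k ^ 2)
    have h12 : Integrable (fun ω => ‖R.noiseSum v k ω‖ ^ 2 +
        2 * v k * inner ℝ (R.r k ω) (R.noiseSum v k ω)) R.μ := h1.add h2
    simp only [he]
    rw [integral_add h12 h3, integral_add h1 h2, integral_const_mul, integral_const_mul,
      R.integral_inner_r k (R.noiseSum_measurable v k) (R.memLp_noiseSum v k),
      Finset.sum_range_succ]
    have h4 := mul_le_mul_of_nonneg_left (R.integral_norm_r_sq_le k) (sq_nonneg (v k))
    linarith

/-- The point x* is deterministic, so every noise term of `step` at u = x* has mean zero and can be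
discarded outright. -/
theorem energy_step {k : ℕ} (hfin : (R.P.h (R.β k) R.p).toENNReal ≠ ⊤) :
    ∫ ω, R.Φ (k + 1) ω R.xs ∂(R.μ) + (1 - R.γ) * ∫ ω, R.a k ω ∂(R.μ) ≤
      ∫ ω, R.Φ k ω R.xs ∂(R.μ) + 2 * (R.τ k * R.hk k) := by
  have hΦ := R.integrable_Φ k R.xs
  have hΦ' := R.integrable_Φ (k + 1) R.xs
  have ha := (R.integrable_a k).const_mul (1 - R.γ)
  have hq := R.integrable_q k
  obtain ⟨hn, hn0⟩ := R.integrable_n_and k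
  have hr := memLp_inner (R.memLp_r k) (memLp_const (μ := R.μ) (p := 2) (R.xs - R.x₀))
  have hr0 := R.integral_inner_r k (Z := fun _ => R.xs - R.x₀) measurable_const (memLp_const _)
  have h1 : ∫ ω, (R.Φ (k + 1) ω R.xs + (1 - R.γ) * R.a k ω) ∂(R.μ) ≤
      ∫ ω, (((R.Φ k ω R.xs + 2 * (R.τ k * R.hk k)) + R.q k ω) + R.n k ω +
        inner ℝ (R.r k ω) (R.xs - R.x₀)) ∂(R.μ) := by
    refine integral_mono (hΦ'.add ha) ((((hΦ.add (integrable_const _)).add hq).add hn).add hr)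
      fun ω => ?_
    have h2 := R.step k ω R.xs_mem
    have h3 := mul_le_mul_of_nonneg_left (R.neg_hk_le hfin (R.y_mem k ω)) (R.hτ k).le
    simp only
    linarith
  have e1 : Integrable (fun ω => R.Φ k ω R.xs + 2 * (R.τ k * R.hk k)) R.μ :=
    hΦ.add (integrable_const _)
  have e2 : Integrable (fun ω => R.Φ k ω R.xs + 2 * (R.τ k * R.hk k) + R.q k ω) R.μ := e1.add hq
  have e3 : Integrable (fun ω => R.Φ k ω R.xs + 2 * (R.τ k * R.hk k) + R.q k ω + R.n k ω) R.μ :=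
    e2.add hn
  rw [integral_add hΦ' ha, integral_add e3 hr, integral_add e2 hn, integral_add e1 hq,
    integral_add hΦ (integrable_const _), integral_const_mul, hr0, hn0, integral_const] at h1
  have h4 := R.integral_q_le k
  simp at h1
  linarith

theorem energy (hH : R.P.hSum R.τ R.β R.p ≠ ⊤) (K : ℕ) :
    ∫ ω, R.Φ K ω R.xs ∂(R.μ) + (1 - R.γ) * ∑ k ∈ Finset.range K, ∫ ω, R.a k ω ∂(R.μ) ≤ R.E₀ := by
  have h : ∫ ω, R.Φ K ω R.xs ∂(R.μ) + (1 - R.γ) * ∑ k ∈ Finset.range K, ∫ ω, R.a k ω ∂(R.μ) ≤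
      2 * ‖R.xs - R.x₀‖ ^ 2 + 2 * ∑ k ∈ Finset.range K, R.τ k * R.hk k := by
    induction K with
    | zero =>
      have h0 := integral_mono (R.integrable_Φ 0 R.xs) (integrable_const _)
        fun ω => R.Φ_zero_le ω R.xs
      simpa using h0
    | succ k ih =>
      have := R.energy_step (R.h_ne_top hH k)
      rw [Finset.sum_range_succ, Finset.sum_range_succ]
      linarith
  have := R.sum_hk_le hH K
  rw [E₀]
  linarith

theorem integral_Φ_le (hH : R.P.hSum R.τ R.β R.p ≠ ⊤) (K : ℕ) :
    ∫ ω, R.Φ K ω R.xs ∂(R.μ) ≤ R.E₀ := by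
  have h1 := R.energy hH K
  have h2 := mul_nonneg (sub_nonneg.2 R.hγ'.le)
    (Finset.sum_nonneg fun k (_ : k ∈ Finset.range K) => R.integral_a_nonneg k)
  linarith

theorem sum_integral_a_le (hH : R.P.hSum R.τ R.β R.p ≠ ⊤) (K : ℕ) :
    ∑ k ∈ Finset.range K, ∫ ω, R.a k ω ∂(R.μ) ≤ R.E₀ / (1 - R.γ) := by
  have h1 := R.energy hH K
  have h2 : 0 ≤ ∫ ω, R.Φ K ω R.xs ∂(R.μ) := integral_nonneg fun ω => R.Φ_nonneg K ω _
  rw [le_div_iff₀ (sub_pos.2 R.hγ')]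
  linarith

theorem integrable_yxs (k : ℕ) : Integrable (fun ω => ‖R.y k ω - R.xs‖ ^ 2) R.μ :=
  ((R.memLp_y k).sub (memLp_const R.xs)).integrable_norm_pow two_ne_zero

/-- Bound for the expected squared distances of the `y_k` from the reference solution. -/
def E₁ : ℝ := 2 / R.θ * (R.E₀ / (1 - R.γ)) + 2 * R.E₀

/-- From y - x* = (y - w) + (w - x*): the first part is controlled by a_k/θ, the second by Φ_k(x*),
both bounded in mean uniformly in k. -/
theorem integral_yxs_le (hH : R.P.hSum R.τ R.β R.p ≠ ⊤) (k : ℕ) :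
    ∫ ω, ‖R.y k ω - R.xs‖ ^ 2 ∂(R.μ) ≤ R.E₁ := by
  have hθ := R.hθ
  have ha := (R.integrable_a k).const_mul (2 / R.θ)
  have hΦ := (R.integrable_Φ k R.xs).const_mul 2
  have h1 : ∫ ω, ‖R.y k ω - R.xs‖ ^ 2 ∂(R.μ) ≤
      ∫ ω, (2 / R.θ * R.a k ω + 2 * R.Φ k ω R.xs) ∂(R.μ) := by
    refine integral_mono (R.integrable_yxs k) (ha.add hΦ) fun ω => ?_
    have h2 := norm_add_le (R.y k ω - R.w k ω) (R.w k ω - R.xs)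
    rw [sub_add_sub_cancel] at h2
    have h3 : 2 * ‖R.y k ω - R.w k ω‖ ^ 2 ≤ 2 / R.θ * R.a k ω := by
      rw [a, mul_add, ← mul_assoc, div_mul_cancel₀ _ hθ.ne']
      exact le_add_of_nonneg_right (by positivity)
    have h4 : ‖R.w k ω - R.xs‖ ^ 2 ≤ R.Φ k ω R.xs :=
      le_add_of_nonneg_left (mul_nonneg (sub_nonneg.2 R.hθ') (sq_nonneg _))
    simp only
    nlinarith [sq_nonneg (‖R.y k ω - R.w k ω‖ - ‖R.w k ω - R.xs‖), norm_nonneg (R.y k ω - R.xs)]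
  rw [integral_add ha hΦ, integral_const_mul, integral_const_mul] at h1
  have h5 : ∫ ω, R.a k ω ∂(R.μ) ≤ R.E₀ / (1 - R.γ) :=
    le_trans (Finset.single_le_sum (f := fun k => ∫ ω, R.a k ω ∂(R.μ))
      (fun k _ => R.integral_a_nonneg k) (Finset.self_mem_range_succ k)) (R.sum_integral_a_le hH _)
  have h6 := R.integral_Φ_le hH k
  have h7 := mul_le_mul_of_nonneg_left h5 (by positivity : 0 ≤ 2 / R.θ)
  rw [E₁]
  linarith

end

end Run

/-- Boundedness is inherited from a compact superset, so that the bound applies to U₁ ∩ S₂ without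
closedness of S₂. -/
theorem le_maxSqDist {X : Type*} [NormedAddCommGroup X] {U V : Set X} (hV : IsCompact V) (hUV : U ⊆ V) (x₀ : X) {u : X}
    (hu : u ∈ U) : ‖u - x₀‖ ^ 2 ≤ maxSqDist U x₀ := by
  have hb : BddAbove ((fun x => ‖x - x₀‖ ^ 2) '' V) :=
    (hV.image (by fun_prop)).bddAbove
  exact le_csSup (hb.mono (Set.image_mono hUV)) ⟨u, hu, rfl⟩

/-! ### Finiteness and measurability of gap functions -/

section Gap

variable {X : Type*} [NormedAddCommGroup X] [InnerProductSpace ℝ X] {g : X → EReal} {C : Set X}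

theorem gap_bounds (hg : ProperConvexLsc g) (F : X → X) (hC : C ⊆ dom g) {x : X} (hx : x ∈ dom g)
    (hne : C.Nonempty) {M : ℝ}
    (hM : ∀ u ∈ C, inner ℝ (F u) (x - u) + (g x).toReal - (g u).toReal ≤ M) :
    (gap F g C x ≠ ⊤ ∧ gap F g C x ≠ ⊥) ∧ (gap F g C x).toReal ≤ M ∧
      ∀ u ∈ C, inner ℝ (F u) (x - u) + (g x).toReal - (g u).toReal ≤ (gap F g C x).toReal := by
  have h1 : gap F g C x ≤ (M : EReal) := iSup₂_le fun u hu => by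
    rw [hg.bifun_eq F hx (hC hu)]
    exact EReal.coe_le_coe_iff.2 (hM u hu)
  have h2 : ∀ u ∈ C, ((inner ℝ (F u) (x - u) + (g x).toReal - (g u).toReal : ℝ) : EReal) ≤
      gap F g C x := fun u hu => by
    rw [← hg.bifun_eq F hx (hC hu)]
    exact le_iSup₂ (f := fun u (_ : u ∈ C) => bifun F g x u) u hu
  have htop : gap F g C x ≠ ⊤ := fun h => by
    rw [h, top_le_iff] at h1
    exact EReal.coe_ne_top _ h1
  have hbot : gap F g C x ≠ ⊥ := fun h => by
    obtain ⟨u, hu⟩ := hne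
    have h3 := h2 u hu
    rw [h, le_bot_iff] at h3
    exact EReal.coe_ne_bot _ h3
  refine ⟨⟨htop, hbot⟩, ?_, fun u hu => ?_⟩
  · rwa [← EReal.coe_le_coe_iff, EReal.coe_toReal htop hbot]
  · have h3 := h2 u hu
    rwa [← EReal.coe_toReal htop hbot, EReal.coe_le_coe_iff] at h3

/-- A supremum over an uncountable set need not preserve measurability, but it preserves lower
semicontinuity. -/
theorem measurable_gap [MeasurableSpace X] [BorelSpace X] (hg : ProperConvexLsc g) (F : X → X)
    (hC : C ⊆ dom g) : Measurable (gap F g C) := by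
  have h : LowerSemicontinuous (gap F g C) := by
    refine lowerSemicontinuous_biSup fun u hu => ?_
    have e : (fun x => bifun F g x u) =
        fun x => ((inner ℝ (F u) (x - u) - (g u).toReal : ℝ) : EReal) + g x := by
      funext x
      rw [bifun, ← hg.coe_toReal (hC hu), EReal.coe_sub, EReal.toReal_coe, sub_eq_add_neg,
        sub_eq_add_neg (inner ℝ (F u) (x - u) : EReal), add_right_comm]
    rw [e]
    refine LowerSemicontinuous.add' ?_ hg.lsc fun x =>
      EReal.continuousAt_add (.inl (EReal.coe_ne_top _)) (.inl (EReal.coe_ne_bot _))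
    exact (continuous_coe_real_ereal.comp (by fun_prop)).lowerSemicontinuous
  exact h.measurable

end Gap

theorem coe_le_coe_ennreal_of_ofReal_le {r : ℝ} {W : ℝ≥0∞} (h : ENNReal.ofReal r ≤ W) :
    (r : EReal) ≤ (W : EReal) := by
  refine le_trans ?_ (EReal.coe_ennreal_le_coe_ennreal_iff.2 h)
  rw [EReal.coe_ennreal_ofReal]
  exact EReal.coe_le_coe_iff.2 (le_max_left _ _)

/-! ### Pathwise bounds at the ergodic average -/

namespace Run

noncomputable section

variable {X A Ξ Ω : Type*} [NormedAddCommGroup X] [InnerProductSpace ℝ X]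
  [MeasurableSpace X] [Fintype A] [MeasurableSpace Ξ] [MeasurableSpace Ω]

variable (R : Run X A Ξ Ω)

/-- The ergodic average. -/
def ybar (K : ℕ) (ω : Ω) : X :=
  R.P.average (1 - R.θ) R.τ R.β R.O R.x₀ (fun k => R.ξ k ω) (fun k => R.b k ω) K

theorem ybar_eq (K : ℕ) (ω : Ω) :
    R.ybar K ω = ∑ k ∈ Finset.range K, ((T R.τ K)⁻¹ * R.τ k) • R.y k ω := by
  simp only [mul_smul, ← Finset.smul_sum]
  rfl

theorem T_pos {K : ℕ} (hK : 1 ≤ K) : 0 < T R.τ K :=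
  Finset.sum_pos (fun k _ => R.hτ k) (Finset.nonempty_range_iff.2 (by omega))

/-- The random, but uniform, part of the upper bounds for the gaps. -/
def err (v : ℕ → ℝ) (K : ℕ) (ω : Ω) : ℝ :=
  ∑ k ∈ Finset.range K, v k * (R.q k ω + R.n k ω) + ‖R.noiseSum v K ω‖ ^ 2 / 6

/-- Trades the Lyapunov function at a varying u for the one at x*, whose mean the energy estimate
bounds. The factor 4 is 2(2-θ) rounded up. -/
theorem Φ_le (k : ℕ) (ω : Ω) (u : X) :
    R.Φ k ω u ≤ 2 * R.Φ k ω R.xs + 4 * ‖u - R.xs‖ ^ 2 := by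
  have key : ∀ v : X, ‖v - u‖ ^ 2 ≤ 2 * ‖v - R.xs‖ ^ 2 + 2 * ‖u - R.xs‖ ^ 2 := by
    intro v
    have h := norm_sub_le (v - R.xs) (u - R.xs)
    rw [sub_sub_sub_cancel_right] at h
    nlinarith [sq_nonneg (‖v - R.xs‖ - ‖u - R.xs‖), norm_nonneg (v - u)]
  have h1 := mul_le_mul_of_nonneg_left (key (R.x k ω)) (sub_nonneg.2 R.hθ')
  have h2 := key (R.w k ω)
  have h3 := mul_nonneg R.hθ.le (sq_nonneg ‖u - R.xs‖)
  simp only [Φ]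
  linarith

/-- Summation by parts for the Lyapunov function. -/
theorem sum_weighted_Φ_le {v : ℕ → ℝ} (hv0 : ∀ k, 0 ≤ v k) (hv : Monotone v) {ω : Ω} {u : X}
    {Ψ : ℕ → ℝ} (hΨ : ∀ k, R.Φ k ω u ≤ Ψ k) (K : ℕ) :
    ∑ k ∈ Finset.range K, v k * (R.Φ k ω u - R.Φ (k + 1) ω u) ≤
      v 0 * Ψ 0 + ∑ k ∈ Finset.range K, (v (k + 1) - v k) * Ψ (k + 1) := by
  -- The induction needs the boundary term -v_KΦ_K, which is dropped only at the end.
  suffices h : ∑ k ∈ Finset.range K, v k * (R.Φ k ω u - R.Φ (k + 1) ω u) ≤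
      v 0 * Ψ 0 + ∑ k ∈ Finset.range K, (v (k + 1) - v k) * Ψ (k + 1) - v K * R.Φ K ω u by
    have := mul_nonneg (hv0 K) (R.Φ_nonneg K ω u)
    linarith
  induction K with
  | zero =>
    have := mul_le_mul_of_nonneg_left (hΨ 0) (hv0 0)
    simp
    linarith
  | succ k ih =>
    have := mul_le_mul_of_nonneg_left (hΨ (k + 1)) (sub_nonneg.2 (hv k.le_succ))
    rw [Finset.sum_range_succ, Finset.sum_range_succ]
    linarith

theorem inner_sub_convex (v u : X) : ConvexOn ℝ R.D fun y => inner ℝ v (y - u) := by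
  refine ⟨R.D_convex, fun x _ y _ a b _ _ hab => le_of_eq ?_⟩
  simp only [smul_eq_mul, inner_sub_right, inner_add_right, inner_smul_right]
  linear_combination (inner ℝ v u) * hab

theorem H₁_convex (u : X) : ConvexOn ℝ R.D fun y => R.H₁ y u :=
  ((R.inner_sub_convex (R.P.F₁ u) u).add R.f₁_convex).add_const (-R.f₁ u)

theorem H₂_convex (u : X) : ConvexOn ℝ R.D fun y => R.H₂ y u :=
  ((R.inner_sub_convex (R.P.F₂ u) u).add R.f₂_convex).add_const (-R.f₂ u)

/-- Lower bound for the upper-level bifunction, uniform over a compact set. -/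
theorem exists_H₁_lower {U : Set X} (hU : IsCompact U) (hUD : U ⊆ R.D) :
    ∃ C : ℝ, 0 < C ∧ ∀ u ∈ U, ∀ y ∈ R.D, -(C * (1 + ‖y - R.xs‖ ^ 2)) ≤ R.H₁ y u := by
  obtain ⟨L, hL⟩ := R.hP.F₁_lip
  obtain ⟨B, hB⟩ := (hU.image hL.continuous).isBounded.exists_norm_le
  obtain ⟨ρ, hρ⟩ := (hU.image (f := fun u => u - R.xs) (by fun_prop)).isBounded.exists_norm_le
  -- Finite variation against the single point x* bounds f₁ from above on U.
  have hvar := R.hvar.var U {R.xs} hU isCompact_singleton hUD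
    (Set.singleton_subset_iff.2 R.xs_mem)
  set M := (variation R.P.g₁ U {R.xs}).toReal
  have hM : ∀ u ∈ U, R.f₁ u - R.f₁ R.xs ≤ M := by
    intro u hu
    have h1 : ENNReal.ofReal |R.f₁ u - R.f₁ R.xs| ≤ variation R.P.g₁ U {R.xs} :=
      (le_iSup₂ (f := fun y (_ : y ∈ ({R.xs} : Set X)) =>
        ENNReal.ofReal |(R.P.g₁ u).toReal - (R.P.g₁ y).toReal|) R.xs rfl).trans
        (le_iSup₂ (f := fun x (_ : x ∈ U) => ⨆ y ∈ ({R.xs} : Set X),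
          ENNReal.ofReal |(R.P.g₁ x).toReal - (R.P.g₁ y).toReal|) u hu)
    have h2 := ENNReal.toReal_mono hvar.ne h1
    rw [ENNReal.toReal_ofReal (abs_nonneg _)] at h2
    exact (le_abs_self _).trans h2
  set c := |B| + ‖R.P.F₁ R.xs‖ + ‖R.p‖
  refine ⟨c + |B| * |ρ| + M + 1, ?_, fun u hu y hy => ?_⟩
  · have : 0 ≤ M := ENNReal.toReal_nonneg
    positivity
  have hM0 : 0 ≤ M := ENNReal.toReal_nonneg
  have h1 := R.H₁_ge hy
  have h2 := hM u hu
  have h3 : ‖R.P.F₁ u‖ ≤ |B| := (hB _ ⟨u, hu, rfl⟩).trans (le_abs_self _)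
  have h4 : ‖u - R.xs‖ ≤ |ρ| := (hρ _ ⟨u, hu, rfl⟩).trans (le_abs_self _)
  have h5 := (abs_le.1 (abs_real_inner_le_norm (R.P.F₁ u) (y - u))).1
  have h6 : ‖y - u‖ ≤ ‖y - R.xs‖ + |ρ| := by
    have h := norm_sub_le (y - R.xs) (u - R.xs)
    rw [sub_sub_sub_cancel_right] at h
    linarith
  have h7 : ‖R.P.F₁ u‖ * ‖y - u‖ ≤ |B| * (‖y - R.xs‖ + |ρ|) :=
    mul_le_mul h3 h6 (norm_nonneg _) (abs_nonneg _)
  have h8 := (abs_le.1 (abs_real_inner_le_norm (R.P.F₁ R.xs) (y - R.xs))).2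
  have h9 := (abs_le.1 (abs_real_inner_le_norm R.p (y - R.xs))).2
  have hc : 0 ≤ c := by positivity
  have h10 : ‖y - R.xs‖ ≤ 1 + ‖y - R.xs‖ ^ 2 := by nlinarith [sq_nonneg (‖y - R.xs‖ - 1)]
  have h11 : c * ‖y - R.xs‖ ≤ c * (1 + ‖y - R.xs‖ ^ 2) := mul_le_mul_of_nonneg_left h10 hc
  have h12 : (|B| * |ρ| + M + 1) * 1 ≤ (|B| * |ρ| + M + 1) * (1 + ‖y - R.xs‖ ^ 2) :=
    mul_le_mul_of_nonneg_left (by nlinarith [sq_nonneg ‖y - R.xs‖]) (by positivity)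
  simp only [H₁] at h1 ⊢
  have h13 : c * ‖y - R.xs‖ = |B| * ‖y - R.xs‖ + ‖R.P.F₁ R.xs‖ * ‖y - R.xs‖ +
    ‖R.p‖ * ‖y - R.xs‖ := by simp only [c]; ring
  nlinarith

/-- At a solution u with multiplier p, the bifunction is at least -⟨p, y - u⟩. Since p is normal at
u, every z in S₂ gives ⟨p, y - u⟩ ≤ ⟨p, y - z⟩, and minimizing over z produces the distance. -/
theorem exists_gapOpt_lower {U : Set X} (hU : (U ∩ R.P.S₁).Nonempty) :
    ∃ B : ℝ, 0 < B ∧ ∃ u ∈ U ∩ R.P.S₂, ∀ y ∈ R.D, -(B * Metric.infDist y R.P.S₂) ≤ R.H₁ y u := by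
  obtain ⟨u, huU, huS⟩ := hU
  obtain ⟨p, hp⟩ := Problem.multipliers_nonempty R.hCQ huS
  -- The added 1 keeps the constant positive when p = 0.
  refine ⟨‖p‖ + 1, by positivity, u, ⟨huU, huS.1⟩, fun y hy => ?_⟩
  refine le_trans ?_ (Problem.multiplier_ineq R.hP hp hy.1)
  rw [neg_le_neg_iff]
  have hne : R.P.S₂.Nonempty := ⟨u, huS.1⟩
  have h1 : inner ℝ p (y - u) ≤ (‖p‖ + 1) * Metric.infDist y R.P.S₂ := by
    rw [← div_le_iff₀' (by positivity), Metric.le_infDist hne]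
    intro z hz
    rw [div_le_iff₀' (by positivity), dist_eq_norm]
    have h2 := hp.1.2 z hz
    have h3 := real_inner_le_norm p (y - z)
    have h4 : inner ℝ p (y - u) = inner ℝ p (y - z) + inner ℝ p (z - u) := by
      rw [← inner_add_right, sub_add_sub_cancel]
    have := norm_nonneg (y - z)
    linarith
  exact h1

variable [FiniteDimensional ℝ X]

theorem ybar_mem {K : ℕ} (hK : 1 ≤ K) (ω : Ω) : R.ybar K ω ∈ R.D := by
  rw [ybar_eq]
  refine R.D_convex.sum_mem (fun k _ => mul_nonneg (inv_nonneg.2 (R.T_pos hK).le) (R.hτ k).le)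
    ?_ fun k _ => R.y_mem k ω
  rw [← Finset.mul_sum]
  exact inv_mul_cancel₀ (R.T_pos hK).ne'

/-- Jensen's inequality for the ergodic average. -/
theorem T_mul_ybar_le {f : X → ℝ} (hf : ConvexOn ℝ R.D f) {K : ℕ} (hK : 1 ≤ K) (ω : Ω) :
    T R.τ K * f (R.ybar K ω) ≤ ∑ k ∈ Finset.range K, R.τ k * f (R.y k ω) := by
  have hT := R.T_pos hK
  have h := hf.map_sum_le (t := Finset.range K) (w := fun k => (T R.τ K)⁻¹ * R.τ k)
    (p := fun k => R.y k ω) (fun k _ => mul_nonneg (inv_nonneg.2 hT.le) (R.hτ k).le)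
    (by rw [← Finset.mul_sum]; exact inv_mul_cancel₀ hT.ne') (fun k _ => R.y_mem k ω)
  rw [← ybar_eq] at h
  simp only [smul_eq_mul, mul_assoc, ← Finset.mul_sum] at h
  rwa [← div_eq_inv_mul, le_div_iff₀' hT] at h

/-- Young's inequality decouples u from the accumulated noise, so the remainder `err` is the same
for all u and survives the supremum. -/
theorem weighted_step {v : ℕ → ℝ} (hv0 : ∀ k, 0 ≤ v k) {u : X} (hu : u ∈ R.D) (K : ℕ) (ω : Ω) :
    ∑ k ∈ Finset.range K, v k * (2 * R.τ k * R.Γ k (R.y k ω) u) ≤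
      ∑ k ∈ Finset.range K, v k * (R.Φ k ω u - R.Φ (k + 1) ω u) +
        3 / 2 * ‖u - R.x₀‖ ^ 2 + R.err v K ω := by
  have h1 : ∑ k ∈ Finset.range K, v k * (2 * R.τ k * R.Γ k (R.y k ω) u) ≤
      ∑ k ∈ Finset.range K, (v k * (R.Φ k ω u - R.Φ (k + 1) ω u) +
        v k * (R.q k ω + R.n k ω) + inner ℝ (v k • R.r k ω) (u - R.x₀)) := by
    refine Finset.sum_le_sum fun k _ => ?_
    have h2 := R.step k ω hu
    have h3 : 0 ≤ (1 - R.γ) * R.a k ω := by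
      have := R.hθ
      refine mul_nonneg (sub_nonneg.2 R.hγ'.le) ?_
      simp only [a]
      positivity
    rw [inner_smul_left, conj_trivial, ← mul_add, ← mul_add]
    exact mul_le_mul_of_nonneg_left (by linarith) (hv0 k)
  rw [Finset.sum_add_distrib, Finset.sum_add_distrib, ← sum_inner] at h1
  have h2 : inner ℝ (∑ k ∈ Finset.range K, v k • R.r k ω) (u - R.x₀) ≤
      3 / 2 * ‖u - R.x₀‖ ^ 2 + ‖R.noiseSum v K ω‖ ^ 2 / 6 := by
    have h3 := real_inner_le_norm (R.noiseSum v K ω) (u - R.x₀)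
    simp only [noiseSum] at *
    -- One sixth of this square gives exactly the constants 3/2 and 1/6.
    nlinarith [sq_nonneg (‖∑ k ∈ Finset.range K, v k • R.r k ω‖ - 3 * ‖u - R.x₀‖)]
  rw [err]
  linarith

/-- Pathwise upper bound for the lower-level bifunction at the ergodic average. -/
theorem H₂_ybar_le {C : ℝ} {u : X} (hu : u ∈ R.D)
    (hC : ∀ y ∈ R.D, -(C * (1 + ‖y - R.xs‖ ^ 2)) ≤ R.H₁ y u) {K : ℕ} (hK : 1 ≤ K) (ω : Ω) :
    2 * T R.τ K * R.H₂ (R.ybar K ω) u ≤ 7 / 2 * ‖u - R.x₀‖ ^ 2 + R.err (fun _ => 1) K ω +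
      ∑ k ∈ Finset.range K, 2 * C * (R.τ k * R.β k) * (1 + ‖R.y k ω - R.xs‖ ^ 2) := by
  have h1 := R.T_mul_ybar_le (R.H₂_convex u) hK ω
  have h2 := R.weighted_step (v := fun _ => 1) (fun _ => zero_le_one) hu K ω
  -- With unit weights the Lyapunov terms telescope; the resulting 2 and Young's 3/2 add up to 7/2.
  have h3 : ∑ k ∈ Finset.range K, (1 : ℝ) * (R.Φ k ω u - R.Φ (k + 1) ω u) ≤
      2 * ‖u - R.x₀‖ ^ 2 := by
    simp only [one_mul]
    rw [Finset.sum_range_sub']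
    have := R.Φ_zero_le ω u
    have := R.Φ_nonneg K ω u
    linarith
  have h4 : ∑ k ∈ Finset.range K, 2 * (R.τ k * R.H₂ (R.y k ω) u) ≤
      ∑ k ∈ Finset.range K, ((1 : ℝ) * (2 * R.τ k * R.Γ k (R.y k ω) u) +
        2 * C * (R.τ k * R.β k) * (1 + ‖R.y k ω - R.xs‖ ^ 2)) := by
    refine Finset.sum_le_sum fun k _ => ?_
    have h5 := R.Γ_ge k (R.y k ω) u
    have h6 := mul_le_mul_of_nonneg_left (hC _ (R.y_mem k ω)) (R.hβ k).le
    have h7 : R.H₂ (R.y k ω) u ≤ R.Γ k (R.y k ω) u +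
        R.β k * (C * (1 + ‖R.y k ω - R.xs‖ ^ 2)) := by linarith
    have h8 := mul_le_mul_of_nonneg_left h7 (R.hτ k).le
    linarith
  rw [Finset.sum_add_distrib, ← Finset.mul_sum] at h4
  linarith

/-- Pathwise upper bound for the upper-level bifunction at the ergodic average. -/
theorem H₁_ybar_le {u : X} (hu : u ∈ R.P.S₂) (huD : u ∈ R.D) {ρ : ℝ} (hρ : ‖u - R.xs‖ ≤ ρ)
    {K : ℕ} (hK : 1 ≤ K) (ω : Ω) :
    2 * T R.τ K * R.H₁ (R.ybar K ω) u ≤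
      ((R.β 0)⁻¹ * (2 * R.Φ 0 ω R.xs + 4 * ρ ^ 2) + ∑ k ∈ Finset.range K,
        ((R.β (k + 1))⁻¹ - (R.β k)⁻¹) * (2 * R.Φ (k + 1) ω R.xs + 4 * ρ ^ 2)) +
      3 / 2 * ‖u - R.x₀‖ ^ 2 + R.err (fun k => (R.β k)⁻¹) K ω := by
  have hv0 : ∀ k, 0 ≤ (R.β k)⁻¹ := fun k => inv_nonneg.2 (R.hβ k).le
  have hv : Monotone fun k => (R.β k)⁻¹ := fun j k h => inv_anti₀ (R.hβ k) (R.hβ' h)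
  have h1 := R.T_mul_ybar_le (R.H₁_convex u) hK ω
  have h2 := R.weighted_step hv0 huD K ω
  have h3 := R.sum_weighted_Φ_le hv0 hv (ω := ω) (u := u)
    (Ψ := fun k => 2 * R.Φ k ω R.xs + 4 * ρ ^ 2) (fun k => (R.Φ_le k ω u).trans (by gcongr)) K
  have h4 : ∑ k ∈ Finset.range K, 2 * (R.τ k * R.H₁ (R.y k ω) u) ≤
      ∑ k ∈ Finset.range K, (R.β k)⁻¹ * (2 * R.τ k * R.Γ k (R.y k ω) u) := by
    refine Finset.sum_le_sum fun k _ => ?_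
    have h5 := R.Γ_ge k (R.y k ω) u
    have h6 := R.H₂_nonneg (R.y_mem k ω) hu
    -- For u in S₂ the lower-level term is nonnegative and is dropped; division by β_k then isolates
    -- the upper level.
    have h7 : R.H₁ (R.y k ω) u ≤ (R.β k)⁻¹ * R.Γ k (R.y k ω) u := by
      rw [← div_eq_inv_mul, le_div_iff₀' (R.hβ k)]
      linarith
    have h8 := mul_le_mul_of_nonneg_left h7 (R.hτ k).le
    linarith
  rw [← Finset.mul_sum] at h4
  linarith

variable [BorelSpace X]

theorem integrable_err (v : ℕ → ℝ) (K : ℕ) : Integrable (R.err v K) R.μ :=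
  (integrable_finsetSum _ fun k _ =>
    ((R.integrable_q k).add (R.integrable_n_and k).1).const_mul _).add
    (((R.memLp_noiseSum v K).integrable_norm_pow two_ne_zero).div_const 6)

/-- The factor 2 is 12/6: the variance constant of r_k over the Young denominator. The q and n terms
contribute nothing positive. -/
theorem integral_err_le {v : ℕ → ℝ} (hv0 : ∀ k, 0 ≤ v k) (K : ℕ) :
    ∫ ω, R.err v K ω ∂(R.μ) ≤ 2 * ∑ k ∈ Finset.range K, v k ^ 2 * ∫ ω, R.a k ω ∂(R.μ) := by
  have hi : ∀ k, Integrable (fun ω => v k * (R.q k ω + R.n k ω)) R.μ := fun k =>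
    ((R.integrable_q k).add (R.integrable_n_and k).1).const_mul _
  have hN := ((R.memLp_noiseSum v K).integrable_norm_pow two_ne_zero).div_const 6
  simp only [err]
  rw [integral_add (integrable_finsetSum _ fun k _ => hi k) hN,
    integral_finsetSum _ fun k _ => hi k, integral_div]
  have h1 : ∑ k ∈ Finset.range K, ∫ ω, v k * (R.q k ω + R.n k ω) ∂(R.μ) ≤ 0 := by
    refine Finset.sum_nonpos fun k _ => ?_
    rw [integral_const_mul, integral_add (R.integrable_q k) (R.integrable_n_and k).1,
      (R.integrable_n_and k).2, add_zero]
    exact mul_nonpos_of_nonneg_of_nonpos (hv0 k) (R.integral_q_le k)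
  have h2 := R.integral_norm_noiseSum_sq_le v K
  linarith

theorem ybar_measurable (K : ℕ) : Measurable (R.ybar K) := by
  have h : R.ybar K = fun ω => ∑ k ∈ Finset.range K, ((T R.τ K)⁻¹ * R.τ k) • R.y k ω :=
    funext fun ω => R.ybar_eq K ω
  rw [h]
  exact Finset.measurable_fun_sum _ fun k _ => (R.y_measurable' k).const_smul _

theorem memLp_ybar (K : ℕ) : MemLp (R.ybar K) 2 R.μ := by
  have h : R.ybar K = fun ω => ∑ k ∈ Finset.range K, ((T R.τ K)⁻¹ * R.τ k) • R.y k ω :=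
    funext fun ω => R.ybar_eq K ω
  rw [h]
  exact memLp_finsetSum _ fun k _ => (R.memLp_y k).const_smul _

theorem integrable_infDist (K : ℕ) :
    Integrable (fun ω => Metric.infDist (R.ybar K ω) R.P.S₂) R.μ := by
  have h1 : Integrable (fun ω => ‖R.ybar K ω - R.xs‖) R.μ :=
    (((R.memLp_ybar K).sub (memLp_const R.xs)).integrable one_le_two).norm
  refine h1.mono' ((Metric.continuous_infDist_pt _).measurable.comp
    (R.ybar_measurable K)).aestronglyMeasurable (Filter.Eventually.of_forall fun ω => ?_)
  rw [Real.norm_of_nonneg Metric.infDist_nonneg, ← dist_eq_norm]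
  exact Metric.infDist_le_dist_of_mem R.hxs.1

end

/-! ### Bounds in expectation -/

noncomputable section

variable {X A Ξ Ω : Type*} [NormedAddCommGroup X] [InnerProductSpace ℝ X]
  [MeasurableSpace X] [Fintype A] [MeasurableSpace Ξ] [MeasurableSpace Ω]

variable (R : Run X A Ξ Ω)

/-- The noise and energy estimates actually give the constant 4 in place of 7. The lemma is used
with t = T_K and with t = T_K β_K². -/
theorem E₀_div_le {t : ℝ} (ht : 0 < t) : 2 * (R.E₀ / (1 - R.γ)) / (2 * t) ≤
    7 / (2 * t * (1 - R.γ)) * R.H + 7 / (2 * t * (1 - R.γ)) * ‖R.xs - R.x₀‖ ^ 2 := by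
  have h1 := sub_pos.2 R.hγ'
  have h2 : 0 ≤ R.H := ENNReal.toReal_nonneg
  have h3 : 0 ≤ 1 / (2 * t * (1 - R.γ)) * (R.H + ‖R.xs - R.x₀‖ ^ 2) := by positivity
  have h4 : 2 * (R.E₀ / (1 - R.γ)) / (2 * t) =
      4 * (1 / (2 * t * (1 - R.γ)) * (R.H + ‖R.xs - R.x₀‖ ^ 2)) := by
    rw [E₀]
    field_simp
    ring
  have h5 : 7 / (2 * t * (1 - R.γ)) * R.H + 7 / (2 * t * (1 - R.γ)) * ‖R.xs - R.x₀‖ ^ 2 =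
      7 * (1 / (2 * t * (1 - R.γ)) * (R.H + ‖R.xs - R.x₀‖ ^ 2)) := by ring
  linarith

variable [FiniteDimensional ℝ X] [BorelSpace X]

theorem integral_err_one_le (hH : R.P.hSum R.τ R.β R.p ≠ ⊤) (K : ℕ) :
    ∫ ω, R.err (fun _ => 1) K ω ∂(R.μ) ≤ 2 * (R.E₀ / (1 - R.γ)) := by
  refine (R.integral_err_le (fun _ => zero_le_one) K).trans ?_
  simp only [one_pow, one_mul]
  exact mul_le_mul_of_nonneg_left (R.sum_integral_a_le hH K) zero_le_two

theorem integral_err_inv_le (hH : R.P.hSum R.τ R.β R.p ≠ ⊤) (K : ℕ) :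
    ∫ ω, R.err (fun k => (R.β k)⁻¹) K ω ∂(R.μ) ≤
      ((R.β K)⁻¹) ^ 2 * (2 * (R.E₀ / (1 - R.γ))) := by
  refine (R.integral_err_le (fun k => inv_nonneg.2 (R.hβ k).le) K).trans ?_
  have h1 : ∑ k ∈ Finset.range K, (R.β k)⁻¹ ^ 2 * ∫ ω, R.a k ω ∂(R.μ) ≤
      ∑ k ∈ Finset.range K, (R.β K)⁻¹ ^ 2 * ∫ ω, R.a k ω ∂(R.μ) := by
    refine Finset.sum_le_sum fun k hk => mul_le_mul_of_nonneg_right ?_ (R.integral_a_nonneg k)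
    exact pow_le_pow_left₀ (inv_nonneg.2 (R.hβ k).le)
      (inv_anti₀ (R.hβ K) (R.hβ' (Finset.mem_range.1 hk).le)) 2
  rw [← Finset.mul_sum] at h1
  have h2 := mul_le_mul_of_nonneg_left (R.sum_integral_a_le hH K) (sq_nonneg (R.β K)⁻¹)
  linarith

/-- The pathwise bound on H₂ is uniform over U, so it bounds the supremum before the expectation is
taken. The constant absorbs the uniform bound `E₁` on the second moments of y_{k+1} - x*. -/
theorem feasibility {U : Set X} (hU : IsCompact U) (hUD : U ⊆ R.D) (hne : (U ∩ R.P.S₂).Nonempty) :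
    ∃ C : ℝ, 0 < C ∧ ∀ K : ℕ, 1 ≤ K →
      (∀ ω, R.P.gapFeas U (R.ybar K ω) ≠ ⊤ ∧ R.P.gapFeas U (R.ybar K ω) ≠ ⊥) ∧
      (∀ ω, ∀ u ∈ U, R.H₂ (R.ybar K ω) u ≤ (R.P.gapFeas U (R.ybar K ω)).toReal) ∧
      Integrable (fun ω => (R.P.gapFeas U (R.ybar K ω)).toReal) R.μ ∧
      ENNReal.ofReal (∫ ω, (R.P.gapFeas U (R.ybar K ω)).toReal ∂(R.μ)) ≤
        WFeas R.τ R.β R.γ R.x₀ R.xs (R.P.hSum R.τ R.β R.p) U C K := by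
  obtain ⟨C, hC0, hC⟩ := R.exists_H₁_lower hU hUD
  obtain ⟨u₀, hu₀, hu₀S⟩ := hne
  refine ⟨C * (1 + |R.E₁|), by positivity, fun K hK => ?_⟩
  have hT := R.T_pos hK
  set bound : Ω → ℝ := fun ω => (7 / 2 * maxSqDist U R.x₀ + R.err (fun _ => 1) K ω +
    ∑ k ∈ Finset.range K, 2 * C * (R.τ k * R.β k) * (1 + ‖R.y k ω - R.xs‖ ^ 2)) / (2 * T R.τ K)
    with hbound
  have hle : ∀ ω, ∀ u ∈ U, R.H₂ (R.ybar K ω) u ≤ bound ω := fun ω u hu => by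
    have h1 := R.H₂_ybar_le (hUD hu) (hC u hu) hK ω
    have h2 := le_maxSqDist hU subset_rfl R.x₀ hu
    rw [hbound, le_div_iff₀ (by positivity)]
    linarith
  have hgap := fun ω => gap_bounds R.hP.g₂_pcl R.P.F₂ (fun u hu => (hUD hu).2)
    (R.ybar_mem hK ω).2 ⟨u₀, hu₀⟩ (hle ω)
  -- A point of U ∩ S₂ makes the gap nonnegative, so an integrable upper bound suffices for
  -- integrability.
  have h0 : ∀ ω, 0 ≤ (R.P.gapFeas U (R.ybar K ω)).toReal := fun ω =>
    (R.H₂_nonneg (R.ybar_mem hK ω) hu₀S).trans ((hgap ω).2.2 u₀ hu₀)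
  have hsum : ∀ k, Integrable
      (fun ω => 2 * C * (R.τ k * R.β k) * (1 + ‖R.y k ω - R.xs‖ ^ 2)) R.μ := fun k =>
    ((integrable_const _).add (R.integrable_yxs k)).const_mul _
  have hconst : Integrable (fun ω => 7 / 2 * maxSqDist U R.x₀ + R.err (fun _ => 1) K ω) R.μ :=
    (integrable_const _).add (R.integrable_err _ K)
  have hbi : Integrable bound R.μ :=
    (hconst.add (integrable_finsetSum _ fun k _ => hsum k)).div_const _
  have hint : Integrable (fun ω => (R.P.gapFeas U (R.ybar K ω)).toReal) R.μ := by
    refine hbi.mono' (((measurable_gap R.hP.g₂_pcl R.P.F₂ fun u hu => (hUD hu).2).comp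
      (R.ybar_measurable K)).ereal_toReal).aestronglyMeasurable
      (Filter.Eventually.of_forall fun ω => ?_)
    rw [Real.norm_of_nonneg (h0 ω)]
    exact (hgap ω).2.1
  refine ⟨fun ω => (hgap ω).1, fun ω => (hgap ω).2.2, hint, ?_⟩
  -- An infinite series has a positive coefficient in the bound, whose value is then ⊤; the energy
  -- estimate is needed only in the finite case.
  by_cases hH : R.P.hSum R.τ R.β R.p = ⊤
  · have h1 : 0 < 7 / (2 * T R.τ K * (1 - R.γ)) := by
      have := sub_pos.2 R.hγ'
      positivity
    have h2 : ENNReal.ofReal (7 / (2 * T R.τ K * (1 - R.γ))) ≠ 0 := by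
      rw [Ne, ENNReal.ofReal_eq_zero]
      exact not_le.2 h1
    rw [WFeas, hH, ENNReal.mul_top h2]
    simp
  · have h1 : ∫ ω, (R.P.gapFeas U (R.ybar K ω)).toReal ∂(R.μ) ≤ ∫ ω, bound ω ∂(R.μ) :=
      integral_mono hint hbi fun ω => (hgap ω).2.1
    have h2 : ∫ ω, bound ω ∂(R.μ) = (7 / 2 * maxSqDist U R.x₀ +
        ∫ ω, R.err (fun _ => 1) K ω ∂(R.μ) + ∑ k ∈ Finset.range K,
          2 * C * (R.τ k * R.β k) * (1 + ∫ ω, ‖R.y k ω - R.xs‖ ^ 2 ∂(R.μ))) / (2 * T R.τ K) := by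
      simp only [hbound]
      rw [integral_div, integral_add hconst (integrable_finsetSum _ fun k _ => hsum k),
        integral_add (integrable_const _) (R.integrable_err _ K),
        integral_finsetSum _ fun k _ => hsum k]
      have hone : ∀ k, ∫ ω, (1 + ‖R.y k ω - R.xs‖ ^ 2) ∂(R.μ) =
          1 + ∫ ω, ‖R.y k ω - R.xs‖ ^ 2 ∂(R.μ) := fun k => by
        rw [integral_add (integrable_const _) (R.integrable_yxs k)]
        simp
      simp only [integral_const_mul, hone, integral_const, probReal_univ, one_smul]
    have h3 : ∑ k ∈ Finset.range K,
        2 * C * (R.τ k * R.β k) * (1 + ∫ ω, ‖R.y k ω - R.xs‖ ^ 2 ∂(R.μ)) ≤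
          2 * (C * (1 + |R.E₁|) * ∑ k ∈ Finset.range K, R.τ k * R.β k) := by
      rw [Finset.mul_sum, Finset.mul_sum]
      refine Finset.sum_le_sum fun k _ => ?_
      have h4 := (R.integral_yxs_le hH k).trans (le_abs_self _)
      have h5 := mul_pos (R.hτ k) (R.hβ k)
      have h6 := mul_le_mul_of_nonneg_left h4 (by positivity : 0 ≤ 2 * C * (R.τ k * R.β k))
      linarith
    have h4 := R.integral_err_one_le hH K
    have h5 := R.E₀_div_le hT
    have h6 : ∫ ω, (R.P.gapFeas U (R.ybar K ω)).toReal ∂(R.μ) ≤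
        7 / (4 * T R.τ K) * maxSqDist U R.x₀ + 7 / (2 * T R.τ K * (1 - R.γ)) * R.H +
          C * (1 + |R.E₁|) * (∑ k ∈ Finset.range K, R.τ k * R.β k) / T R.τ K +
          7 / (2 * T R.τ K * (1 - R.γ)) * ‖R.xs - R.x₀‖ ^ 2 := by
      refine (h1.trans_eq h2).trans ?_
      have h7 : (7 / 2 * maxSqDist U R.x₀ + ∫ ω, R.err (fun _ => 1) K ω ∂(R.μ) +
          ∑ k ∈ Finset.range K, 2 * C * (R.τ k * R.β k) *
            (1 + ∫ ω, ‖R.y k ω - R.xs‖ ^ 2 ∂(R.μ))) / (2 * T R.τ K) ≤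
          (7 / 2 * maxSqDist U R.x₀ + 2 * (R.E₀ / (1 - R.γ)) +
            2 * (C * (1 + |R.E₁|) * ∑ k ∈ Finset.range K, R.τ k * R.β k)) / (2 * T R.τ K) := by
        gcongr
      have h8 : (7 / 2 * maxSqDist U R.x₀ + 2 * (R.E₀ / (1 - R.γ)) +
            2 * (C * (1 + |R.E₁|) * ∑ k ∈ Finset.range K, R.τ k * R.β k)) / (2 * T R.τ K) =
          7 / (4 * T R.τ K) * maxSqDist U R.x₀ + 2 * (R.E₀ / (1 - R.γ)) / (2 * T R.τ K) +
            C * (1 + |R.E₁|) * (∑ k ∈ Finset.range K, R.τ k * R.β k) / T R.τ K := by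
        field_simp
        ring
      linarith
    refine (ENNReal.ofReal_le_ofReal h6).trans ?_
    have hγ := sub_pos.2 R.hγ'
    have h9 : ENNReal.ofReal (7 / (2 * T R.τ K * (1 - R.γ)) * R.H) =
        ENNReal.ofReal (7 / (2 * T R.τ K * (1 - R.γ))) * R.P.hSum R.τ R.β R.p := by
      rw [ENNReal.ofReal_mul (by positivity), H, ENNReal.ofReal_toReal hH]
    rw [WFeas, ← h9]
    refine ENNReal.ofReal_add_le.trans (add_le_add_left ?_ _)
    exact ENNReal.ofReal_add_le.trans (add_le_add_left ENNReal.ofReal_add_le _)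

/-- With the weights 1/β_k, Abel summation bounds the Lyapunov contribution by a constant over β_K,
and the noise contribution carries the largest squared weight 1/β_K². -/
theorem optimality {U : Set X} (hU : IsCompact U) (hUD : U ⊆ dom R.P.g₁)
    (hne : (U ∩ R.P.S₁).Nonempty) :
    ∃ B : ℝ, 0 < B ∧ ∃ C : ℝ, 0 < C ∧ ∀ K : ℕ, 1 ≤ K →
      (∀ ω, R.P.gapOpt U (R.ybar K ω) ≠ ⊤ ∧ R.P.gapOpt U (R.ybar K ω) ≠ ⊥) ∧
      (∀ ω, -(B * Metric.infDist (R.ybar K ω) R.P.S₂) ≤ (R.P.gapOpt U (R.ybar K ω)).toReal) ∧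
      Integrable (fun ω => (R.P.gapOpt U (R.ybar K ω)).toReal) R.μ ∧
      ENNReal.ofReal (∫ ω, (R.P.gapOpt U (R.ybar K ω)).toReal ∂(R.μ)) ≤
        WOpt R.τ R.β R.γ R.x₀ R.xs (R.P.hSum R.τ R.β R.p) (U ∩ R.P.S₂) C K := by
  obtain ⟨B, hB0, u₀, hu₀, hB⟩ := R.exists_gapOpt_lower hne
  obtain ⟨ρ, hρ⟩ := (hU.image (f := fun u => u - R.xs) (by fun_prop)).isBounded.exists_norm_le
  have hD : ∀ u ∈ U ∩ R.P.S₂, u ∈ R.D := fun u hu =>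
    ⟨hUD hu.1, (Problem.lower_vi R.hP hu.2).1⟩
  -- This bounds the mean of 2Φ_k(x*) + 4ρ² for all k, where ρ bounds ‖u - x*‖ on U; the 1 ensures
  -- positivity.
  refine ⟨B, hB0, 2 * |R.E₀| + 4 * ρ ^ 2 + 1, by positivity, fun K hK => ?_⟩
  have hT := R.T_pos hK
  set Ψ : ℕ → Ω → ℝ := fun k ω => 2 * R.Φ k ω R.xs + 4 * ρ ^ 2 with hΨ
  have hΨi : ∀ k, Integrable (Ψ k) R.μ := fun k =>
    ((R.integrable_Φ k R.xs).const_mul 2).add (integrable_const _)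
  set bound : Ω → ℝ := fun ω => (((R.β 0)⁻¹ * Ψ 0 ω + ∑ k ∈ Finset.range K,
    ((R.β (k + 1))⁻¹ - (R.β k)⁻¹) * Ψ (k + 1) ω) + 3 / 2 * maxSqDist (U ∩ R.P.S₂) R.x₀ +
      R.err (fun k => (R.β k)⁻¹) K ω) / (2 * T R.τ K) with hbound
  have hle : ∀ ω, ∀ u ∈ U ∩ R.P.S₂, R.H₁ (R.ybar K ω) u ≤ bound ω := fun ω u hu => by
    have h1 := R.H₁_ybar_le hu.2 (hD u hu) (hρ _ ⟨u, hu.1, rfl⟩) hK ω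
    have h2 := le_maxSqDist hU Set.inter_subset_left R.x₀ hu
    rw [hbound, le_div_iff₀ (by positivity)]
    simp only [hΨ]
    linarith
  have hgap := fun ω => gap_bounds R.hP.g₁_pcl R.P.F₁ (C := U ∩ R.P.S₂) (fun u hu => hUD hu.1)
    (R.ybar_mem hK ω).1 ⟨u₀, hu₀⟩ (hle ω)
  have hlow : ∀ ω, -(B * Metric.infDist (R.ybar K ω) R.P.S₂) ≤
      (R.P.gapOpt U (R.ybar K ω)).toReal := fun ω =>
    (hB _ (R.ybar_mem hK ω)).trans ((hgap ω).2.2 u₀ hu₀)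
  have hsi : Integrable (fun ω => ∑ k ∈ Finset.range K,
      ((R.β (k + 1))⁻¹ - (R.β k)⁻¹) * Ψ (k + 1) ω) R.μ :=
    integrable_finsetSum _ fun k _ => (hΨi (k + 1)).const_mul _
  have hi1 : Integrable (fun ω => (R.β 0)⁻¹ * Ψ 0 ω + ∑ k ∈ Finset.range K,
      ((R.β (k + 1))⁻¹ - (R.β k)⁻¹) * Ψ (k + 1) ω) R.μ := ((hΨi 0).const_mul _).add hsi
  have hi2 : Integrable (fun ω => ((R.β 0)⁻¹ * Ψ 0 ω + ∑ k ∈ Finset.range K,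
      ((R.β (k + 1))⁻¹ - (R.β k)⁻¹) * Ψ (k + 1) ω) +
        3 / 2 * maxSqDist (U ∩ R.P.S₂) R.x₀) R.μ := hi1.add (integrable_const _)
  have hbi : Integrable bound R.μ := (hi2.add (R.integrable_err _ K)).div_const _
  have hint : Integrable (fun ω => (R.P.gapOpt U (R.ybar K ω)).toReal) R.μ := by
    -- This gap can be negative, so domination also needs the lower bound by the integrable
    -- distance.
    refine (hbi.norm.add ((R.integrable_infDist K).const_mul B)).mono'
      (((measurable_gap R.hP.g₁_pcl R.P.F₁ fun u hu => hUD hu.1).comp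
        (R.ybar_measurable K)).ereal_toReal).aestronglyMeasurable
      (Filter.Eventually.of_forall fun ω => ?_)
    have h1 := hlow ω
    have h2 : (R.P.gapOpt U (R.ybar K ω)).toReal ≤ bound ω := (hgap ω).2.1
    have h3 := le_abs_self (bound ω)
    have h4 := mul_nonneg hB0.le (Metric.infDist_nonneg (x := R.ybar K ω) (s := R.P.S₂))
    have h5 := abs_nonneg (bound ω)
    simp only [Pi.add_apply, Real.norm_eq_abs]
    exact abs_le.2 ⟨by linarith, by linarith⟩
  refine ⟨fun ω => (hgap ω).1, hlow, hint, ?_⟩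
  have hγ := sub_pos.2 R.hγ'
  have hβK := R.hβ K
  have hc : 0 < 7 / (2 * (1 - R.γ) * T R.τ K * R.β K ^ 2) := by positivity
  by_cases hH : R.P.hSum R.τ R.β R.p = ⊤
  · have h2 : ENNReal.ofReal (7 / (2 * (1 - R.γ) * T R.τ K * R.β K ^ 2)) ≠ 0 := by
      rw [Ne, ENNReal.ofReal_eq_zero]
      exact not_le.2 hc
    rw [WOpt, hH, ENNReal.mul_top h2]
    simp
  · have h1 : ∫ ω, (R.P.gapOpt U (R.ybar K ω)).toReal ∂(R.μ) ≤ ∫ ω, bound ω ∂(R.μ) :=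
      integral_mono hint hbi fun ω => (hgap ω).2.1
    set c := 2 * |R.E₀| + 4 * ρ ^ 2 + 1 with hcdef
    have hΨle : ∀ k, ∫ ω, Ψ k ω ∂(R.μ) ≤ c := by
      intro k
      have h2 := R.integral_Φ_le hH k
      simp only [hΨ]
      rw [integral_add ((R.integrable_Φ k R.xs).const_mul 2) (integrable_const _),
        integral_const_mul]
      have := le_abs_self R.E₀
      simp only [integral_const, probReal_univ, one_smul]
      linarith
    have h2 : ∫ ω, bound ω ∂(R.μ) = (((R.β 0)⁻¹ * ∫ ω, Ψ 0 ω ∂(R.μ) + ∑ k ∈ Finset.range K,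
        ((R.β (k + 1))⁻¹ - (R.β k)⁻¹) * ∫ ω, Ψ (k + 1) ω ∂(R.μ)) +
        3 / 2 * maxSqDist (U ∩ R.P.S₂) R.x₀ +
          ∫ ω, R.err (fun k => (R.β k)⁻¹) K ω ∂(R.μ)) / (2 * T R.τ K) := by
      simp only [hbound]
      rw [integral_div, integral_add hi2 (R.integrable_err _ K),
        integral_add hi1 (integrable_const _), integral_add ((hΨi 0).const_mul _) hsi,
        integral_finsetSum _ fun k _ => (hΨi (k + 1)).const_mul _]
      simp only [integral_const_mul, integral_const, probReal_univ, one_smul]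
    have h3 : (R.β 0)⁻¹ * ∫ ω, Ψ 0 ω ∂(R.μ) + ∑ k ∈ Finset.range K,
        ((R.β (k + 1))⁻¹ - (R.β k)⁻¹) * ∫ ω, Ψ (k + 1) ω ∂(R.μ) ≤ (R.β K)⁻¹ * c := by
      have h4 : ∑ k ∈ Finset.range K,
          ((R.β (k + 1))⁻¹ - (R.β k)⁻¹) * ∫ ω, Ψ (k + 1) ω ∂(R.μ) ≤
          ∑ k ∈ Finset.range K, ((R.β (k + 1))⁻¹ - (R.β k)⁻¹) * c :=
        Finset.sum_le_sum fun k _ => mul_le_mul_of_nonneg_left (hΨle (k + 1))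
          (sub_nonneg.2 (inv_anti₀ (R.hβ (k + 1)) (R.hβ' k.le_succ)))
      -- The increments of 1/β_k are nonnegative and telescope, so together with the initial term
      -- they leave c/β_K.
      rw [← Finset.sum_mul, Finset.sum_range_sub fun k => (R.β k)⁻¹] at h4
      have h5 := mul_le_mul_of_nonneg_left (hΨle 0) (inv_nonneg.2 (R.hβ 0).le)
      linarith
    have h4 := R.integral_err_inv_le hH K
    have h6 : ∫ ω, (R.P.gapOpt U (R.ybar K ω)).toReal ∂(R.μ) ≤
        c / (2 * T R.τ K * R.β K) + 3 / (4 * T R.τ K) * maxSqDist (U ∩ R.P.S₂) R.x₀ +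
          7 / (2 * (1 - R.γ) * T R.τ K * R.β K ^ 2) * ‖R.xs - R.x₀‖ ^ 2 +
          7 / (2 * (1 - R.γ) * T R.τ K * R.β K ^ 2) * R.H := by
      refine (h1.trans_eq h2).trans ?_
      have h7 : (((R.β 0)⁻¹ * ∫ ω, Ψ 0 ω ∂(R.μ) + ∑ k ∈ Finset.range K,
          ((R.β (k + 1))⁻¹ - (R.β k)⁻¹) * ∫ ω, Ψ (k + 1) ω ∂(R.μ)) +
          3 / 2 * maxSqDist (U ∩ R.P.S₂) R.x₀ +
            ∫ ω, R.err (fun k => (R.β k)⁻¹) K ω ∂(R.μ)) / (2 * T R.τ K) ≤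
          ((R.β K)⁻¹ * c + 3 / 2 * maxSqDist (U ∩ R.P.S₂) R.x₀ +
            (R.β K)⁻¹ ^ 2 * (2 * (R.E₀ / (1 - R.γ)))) / (2 * T R.τ K) := by
        gcongr
      have h8 : ((R.β K)⁻¹ * c + 3 / 2 * maxSqDist (U ∩ R.P.S₂) R.x₀ +
            (R.β K)⁻¹ ^ 2 * (2 * (R.E₀ / (1 - R.γ)))) / (2 * T R.τ K) =
          c / (2 * T R.τ K * R.β K) + 3 / (4 * T R.τ K) * maxSqDist (U ∩ R.P.S₂) R.x₀ +
            2 * (R.E₀ / (1 - R.γ)) / (2 * (T R.τ K * R.β K ^ 2)) := by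
        field_simp
        ring
      have h9 := R.E₀_div_le (t := T R.τ K * R.β K ^ 2) (by positivity)
      have h10 : 2 * (T R.τ K * R.β K ^ 2) * (1 - R.γ) =
        2 * (1 - R.γ) * T R.τ K * R.β K ^ 2 := by ring
      rw [h10] at h9
      linarith
    refine (ENNReal.ofReal_le_ofReal h6).trans ?_
    have h9 : ENNReal.ofReal (7 / (2 * (1 - R.γ) * T R.τ K * R.β K ^ 2) * R.H) =
        ENNReal.ofReal (7 / (2 * (1 - R.γ) * T R.τ K * R.β K ^ 2)) * R.P.hSum R.τ R.β R.p := by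
      rw [ENNReal.ofReal_mul hc.le, H, ENNReal.ofReal_toReal hH]
    rw [WOpt, ← h9]
    refine ENNReal.ofReal_add_le.trans (add_le_add_left ?_ _)
    exact ENNReal.ofReal_add_le.trans (add_le_add_left ENNReal.ofReal_add_le _)

/-- Under weak sharpness, a bound for the expected feasibility gap bounds the expected distance
from the lower-level solution set. -/
theorem integral_infDist_le_of_weaklySharp {U : Set X} (hne : (U ∩ R.P.S₂).Nonempty) {K : ℕ}
    (hK : 1 ≤ K) {gap : Ω → ℝ} (hgap : Integrable gap R.μ)
    (hle : ∀ ω, ∀ u ∈ U, R.H₂ (R.ybar K ω) u ≤ gap ω) {W : ℝ≥0∞}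
    (hW : ENNReal.ofReal (∫ ω, gap ω ∂(R.μ)) ≤ W) {κ ρ : ℝ}
    (hs : WeaklySharp R.P.F₂ R.P.g₂ R.P.S₂ κ ρ) :
    ENNReal.ofReal (∫ ω, Metric.infDist (R.ybar K ω) R.P.S₂ ∂(R.μ)) ≤
      (ENNReal.ofReal (ρ / κ) * W) ^ (1 / ρ) := by
  obtain ⟨hκ, hρ, hs⟩ := hs
  have hρ0 : 0 < ρ := zero_lt_one.trans_le hρ
  obtain ⟨u, hu, huS⟩ := hne
  set δ : Ω → ℝ := fun ω => Metric.infDist (R.ybar K ω) R.P.S₂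
  have hδ0 : ∀ ω, 0 ≤ δ ω := fun ω => Metric.infDist_nonneg
  have hpt : ∀ ω, δ ω ^ ρ ≤ ρ / κ * gap ω := by
    intro ω
    have hD := R.ybar_mem hK ω
    have h1 := hs u huS _ hD.2
    rw [R.hP.g₂_pcl.bifun_eq R.P.F₂ hD.2 (Problem.lower_vi R.hP huS).1,
      EReal.coe_le_coe_iff] at h1
    have h2 : κ / ρ * δ ω ^ ρ ≤ gap ω := h1.trans (hle ω u hu)
    have h3 := mul_le_mul_of_nonneg_left h2 (by positivity : 0 ≤ ρ / κ)
    rwa [← mul_assoc, div_mul_div_cancel₀ hκ.ne', div_self hρ0.ne', one_mul] at h3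
  have hδi : Integrable δ R.μ := R.integrable_infDist K
  have hδm : Measurable δ :=
    (Metric.continuous_infDist_pt _).measurable.comp (R.ybar_measurable K)
  have hδρ : Integrable (fun ω => δ ω ^ ρ) R.μ := by
    refine (hgap.const_mul (ρ / κ)).mono' (hδm.pow_const ρ).aestronglyMeasurable
      (Filter.Eventually.of_forall fun ω => ?_)
    rw [Real.norm_of_nonneg (Real.rpow_nonneg (hδ0 ω) ρ)]
    exact hpt ω
  -- Weak sharpness controls only the ρ-th power of the distance; convexity of the power (ρ ≥ 1)
  -- transfers this to the mean distance.
  have hJ : (∫ ω, δ ω ∂(R.μ)) ^ ρ ≤ ∫ ω, δ ω ^ ρ ∂(R.μ) :=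
    (convexOn_rpow hρ).map_integral_le (Real.continuous_rpow_const hρ0.le).continuousOn
      isClosed_Ici (Filter.Eventually.of_forall hδ0) hδi hδρ
  have h1 : (∫ ω, δ ω ∂(R.μ)) ^ ρ ≤ ρ / κ * ∫ ω, gap ω ∂(R.μ) := by
    rw [← integral_const_mul]
    exact hJ.trans (integral_mono hδρ (hgap.const_mul _) hpt)
  have h0 : 0 ≤ ∫ ω, δ ω ∂(R.μ) := integral_nonneg hδ0
  rw [one_div, ENNReal.le_rpow_inv_iff hρ0, ENNReal.ofReal_rpow_of_nonneg h0 hρ0.le]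
  refine (ENNReal.ofReal_le_ofReal h1).trans ?_
  rw [ENNReal.ofReal_mul (by positivity)]
  gcongr

end

end Run

end HierVI

theorem theorem1
    {X A Ξ Ω : Type*} [NormedAddCommGroup X] [InnerProductSpace ℝ X] [FiniteDimensional ℝ X]
    [MeasurableSpace X] [BorelSpace X] [Fintype A] [MeasurableSpace Ξ] [MeasurableSpace Ω]
    (P : HierVI.Problem X A) (hP : P.Standing) (hvar : P.FiniteVariation) (hCQ : P.CQ)
    (θ α γ : ℝ) (hθ : 0 < θ) (hθ' : θ ≤ 1) (hα : α = 1 - θ) (hγ : 0 < γ) (hγ' : γ < 1)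
    (τ β ℒ : ℕ → ℝ) (hτ : ∀ k, 0 < τ k) (hβ : ∀ k, 0 < β k) (hβ' : Antitone β)
    (Q : Measure Ξ) [IsProbabilityMeasure Q] (O : ℕ → Ξ → X → X)
    (hO : P.Oracle β Q O ℒ) (hτ' : ∀ k, τ k ≤ √θ / ℒ k * γ)
    (hAC : P.AttouchCzarnecki τ β)
    (μ : Measure Ω) [IsProbabilityMeasure μ] (ξ : ℕ → Ω → Ξ) (b : ℕ → Ω → Bool)
    (hS : HierVI.Sampling μ Q θ ξ b) (x₀ : X)
    (ybar : ℕ → Ω → X)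
    (hy : ∀ K ω, ybar K ω =
      P.average α τ β O x₀ (fun k => ξ k ω) (fun k => b k ω) K)
    (xs : X) (hxs : xs ∈ P.S₁) :
    (P.multipliers xs).Nonempty ∧ ∀ p ∈ P.multipliers xs,
    ∃ C₁ C₂ B : Set X → ℝ, ∀ U₁ U₂ : Set X,
      IsCompact U₁ → U₁ ⊆ HierVI.dom P.g₁ → (U₁ ∩ P.S₁).Nonempty →
      IsCompact U₂ → U₂ ⊆ HierVI.dom P.g₁ ∩ HierVI.dom P.g₂ → (U₂ ∩ P.S₂).Nonempty →
      0 < C₁ U₁ ∧ 0 < C₂ U₂ ∧ 0 < B U₁ ∧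
      ∀ K : ℕ, 1 ≤ K →
        -- the feasibility gap is finite and integrable, with the upper bound in expectation
        ((∀ ω, P.gapFeas U₂ (ybar K ω) ≠ ⊤ ∧ P.gapFeas U₂ (ybar K ω) ≠ ⊥) ∧
          Integrable (fun ω => (P.gapFeas U₂ (ybar K ω)).toReal) μ ∧
          ((∫ ω, (P.gapFeas U₂ (ybar K ω)).toReal ∂μ : ℝ) : EReal) ≤
            HierVI.WFeas τ β γ x₀ xs (P.hSum τ β p) U₂ (C₂ U₂) K) ∧
        -- the optimality gap is finite and integrable, with the upper bound in expectation
        ((∀ ω, P.gapOpt U₁ (ybar K ω) ≠ ⊤ ∧ P.gapOpt U₁ (ybar K ω) ≠ ⊥) ∧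
          Integrable (fun ω => (P.gapOpt U₁ (ybar K ω)).toReal) μ ∧
          ((∫ ω, (P.gapOpt U₁ (ybar K ω)).toReal ∂μ : ℝ) : EReal) ≤
            HierVI.WOpt τ β γ x₀ xs (P.hSum τ β p) (U₁ ∩ P.S₂) (C₁ U₁) K) ∧
        -- the lower bound on the optimality gap, pointwise and in expectation
        ((∀ ω, -(B U₁ * Metric.infDist (ybar K ω) P.S₂) ≤ (P.gapOpt U₁ (ybar K ω)).toReal) ∧
          Integrable (fun ω => Metric.infDist (ybar K ω) P.S₂) μ ∧
          -(B U₁ * ∫ ω, Metric.infDist (ybar K ω) P.S₂ ∂μ) ≤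
            ∫ ω, (P.gapOpt U₁ (ybar K ω)).toReal ∂μ) ∧
        -- the lower bound under weak sharpness
        (∀ κ ρ : ℝ, HierVI.WeaklySharp P.F₂ P.g₂ P.S₂ κ ρ →
          -((ENNReal.ofReal (B U₁) * (ENNReal.ofReal (ρ / κ) *
              HierVI.WFeas τ β γ x₀ xs (P.hSum τ β p) U₂ (C₂ U₂) K) ^ (1 / ρ) : ℝ≥0∞) : EReal) ≤
            ((∫ ω, (P.gapOpt U₁ (ybar K ω)).toReal ∂μ : ℝ) : EReal)) := by
  refine ⟨HierVI.Problem.multipliers_nonempty hCQ hxs, fun p hp => ?_⟩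
  subst hα
  let R : HierVI.Run X A Ξ Ω :=
    { P, hP, hvar, hCQ, θ, γ, hθ, hθ', hγ, hγ', τ, β, ℒ, hτ, hβ, hβ', Q, hQ := inferInstance, O, hO,
      hτ', μ, hμ := inferInstance, ξ, b, hS, x₀, xs, hxs, p, hp }
  obtain rfl : ybar = R.ybar := funext fun K => funext fun ω => hy K ω
  -- Constants are chosen separately for each set, with the junk value 0 when the set is not
  -- admissible. They thereby become functions of U₁ alone or U₂ alone, and do not depend on K.
  have hopt : ∀ U : Set X, ∃ B C : ℝ, IsCompact U → U ⊆ HierVI.dom P.g₁ → (U ∩ P.S₁).Nonempty → _ :=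
    fun U => by
      by_cases h : IsCompact U ∧ U ⊆ HierVI.dom P.g₁ ∧ (U ∩ P.S₁).Nonempty
      · obtain ⟨B, hB, C, hC⟩ := R.optimality h.1 h.2.1 h.2.2
        exact ⟨B, C, fun _ _ _ => And.intro hB hC⟩
      · exact ⟨0, 0, fun h1 h2 h3 => absurd ⟨h1, h2, h3⟩ h⟩
  have hfeas : ∀ U : Set X, ∃ C : ℝ, IsCompact U → U ⊆ HierVI.dom P.g₁ ∩ HierVI.dom P.g₂ →
      (U ∩ P.S₂).Nonempty → _ := fun U => by
    by_cases h : IsCompact U ∧ U ⊆ HierVI.dom P.g₁ ∩ HierVI.dom P.g₂ ∧ (U ∩ P.S₂).Nonempty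
    · obtain ⟨C, hC⟩ := R.feasibility h.1 h.2.1 h.2.2
      exact ⟨C, fun _ _ _ => hC⟩
    · exact ⟨0, fun h1 h2 h3 => absurd ⟨h1, h2, h3⟩ h⟩
  choose B C₁ hopt using hopt
  choose C₂ hfeas using hfeas
  refine ⟨C₁, C₂, B, fun U₁ U₂ hU₁ hU₁' hU₁S hU₂ hU₂' hU₂S => ?_⟩
  obtain ⟨hB, hC₁, hopt⟩ := hopt U₁ hU₁ hU₁' hU₁S
  obtain ⟨hC₂, hfeas⟩ := hfeas U₂ hU₂ hU₂' hU₂S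
  refine ⟨hC₁, hC₂, hB, fun K hK => ?_⟩
  obtain ⟨hfin, hle, hint, hW⟩ := hfeas K hK
  obtain ⟨hfin', hlow, hint', hW'⟩ := hopt K hK
  have hdist := R.integrable_infDist K
  have hlowE : -(B U₁ * ∫ ω, Metric.infDist (R.ybar K ω) P.S₂ ∂μ) ≤
      ∫ ω, (P.gapOpt U₁ (R.ybar K ω)).toReal ∂μ := by
    rw [← integral_const_mul, ← integral_neg]
    exact integral_mono (hdist.const_mul _).neg hint' hlow
  refine ⟨⟨hfin, hint, HierVI.coe_le_coe_ennreal_of_ofReal_le hW⟩,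
    ⟨hfin', hint', HierVI.coe_le_coe_ennreal_of_ofReal_le hW'⟩, ⟨hlow, hdist, hlowE⟩,
    fun κ ρ hs => ?_⟩
  have h1 := R.integral_infDist_le_of_weaklySharp hU₂S hK hint hle hW hs
  have h2 : ENNReal.ofReal (B U₁ * ∫ ω, Metric.infDist (R.ybar K ω) P.S₂ ∂μ) ≤
      ENNReal.ofReal (B U₁) * (ENNReal.ofReal (ρ / κ) *
        HierVI.WFeas τ β γ x₀ xs (P.hSum τ β p) U₂ (C₂ U₂) K) ^ (1 / ρ) := by
    rw [ENNReal.ofReal_mul hB.le]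
    exact mul_le_mul_right h1 _
  refine (EReal.neg_le_neg_iff.2 (HierVI.coe_le_coe_ennreal_of_ofReal_le h2)).trans ?_
  rw [← EReal.coe_neg]
  exact EReal.coe_le_coe_iff.2 hlowE
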